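/- For an origin-symmetric convex body $K\subset\mathbb{R}^2$ let $\|\cdot\|_K$ be the norm with unit ball $K$. For non-zero $x,y$ write $x\dashv y$ (Birkhoff orthogonality) if $\|x\|_K\le\|x+ty\|_K$ for all $t\in\mathbb{R}$. A point $x\in\operatorname{bd}K$ is an *Auerbach point* if there is $y\in\operatorname{bd}K$ with $x\dashv y$ and $y\dashv x$; $A(K)$ denotes the set of Auerbach points. A *B-measure* on $\operatorname{bd}K$ is a Borel measure $\mu$ on $\operatorname{bd}K$ with $\mu(\operatorname{bd}K)=2\pi$, $\mu(X)=\mu(-X)$ for all Borel $X\subseteq\operatorname{bd}K$, $\mu(\{x\})=0$ for all $x\in\operatorname{bd}K$, and $\mu(C)=\pi/2$ for every closed arc $C\subseteq\operatorname{bd}K$ that contains no two opposite points and whose end points $x,y$ satisfy $x\dashv y$. Let $\Psi(s)=\exp\left(-\frac1{1-s^2}\right)$ for $|s|<1$ and $\Psi(s)=0$ otherwise. Let $C$ be the arc of the Euclidean unit circle with polar angles in $[-3\pi/8,3\pi/8]$, and let $C_0\subset C$ be the Cantor set in $C$, that is, the image of the ternary Cantor set under the parametrization of $C$ by $[0,1]$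 proportional to arc length. There is an origin-symmetric convex body $K\subset\mathbb{R}^2$ which is strictly convex and smooth (it has exactly one support line at each boundary point, and $\operatorname{bd}K$ is a regular $C^\infty$ curve) such that: 1. $\operatorname{bd}K$ is obtained from the Euclidean unit circle by replacing each removed open arc of $C\setminus C_0$, with polar angles $(\alpha_0,\alpha_1)$, by the curve given in polar coordinates by $r(\varphi)=1-\varepsilon\,\Psi\left(\frac{2}{\alpha_1-\alpha_0}\left[\varphi-\frac{\alpha_0+\alpha_1}{2}\right]\right)$, $\varphi\in[\alpha_0,\alpha_1]$, for some $\varepsilon>0$ depending on the arc, and by replacing the opposite arc by the opposite curve; 2. $A(K)=C_0\cup(-C_0)\cup D$, where $C_0$ and $-C_0$ are disjoint copies of the Cantor set and $D$ is a countably infinite set of isolated points of $A(K)$; 3. $A(K)$ has one-dimensional Lebesgue (Hausdorff) measure zero; 4. there is a B-measure on $\operatorname{bd}K$. -/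

import Mathlib

open MeasureTheory
open scoped Pointwise ContDiff ENNReal

noncomputable section

namespace NormedPlane

/-- The Euclidean plane. -/
abbrev Plane : Type := EuclideanSpace ℝ (Fin 2)

/-- An origin-symmetric convex body: compact, convex, with interior points, and `-K = K`. -/
structure IsSymmetricBody (K : Set Plane) : Prop where
  convex : Convex ℝ K
  compact : IsCompact K
  interior_nonempty : (interior K).Nonempty
  symmetric : -K = K

/-- The line through `x` with direction `v` supports `K` at its boundary point `x`. -/
def IsSupportDirection (K : Set Plane) (x v : Plane) : Prop :=
  v ≠ 0 ∧ ∀ t : ℝ, x + t • v ∉ interior K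

/-- Smoothness in the sense of convex geometry: every boundary point has only one support line. -/
def HasUniqueSupportLines (K : Set Plane) : Prop :=
  ∀ x ∈ frontier K, ∀ u v : Plane, IsSupportDirection K x u → IsSupportDirection K x v →
    ∃ c : ℝ, v = c • u

/-- The boundary is a regular curve of class `C^∞`. -/
def HasSmoothBoundary (K : Set Plane) : Prop :=
  ∃ γ : ℝ → Plane, ContDiff ℝ ∞ γ ∧ (∀ t, deriv γ t ≠ 0) ∧ Set.range γ = frontier K

/-- Birkhoff orthogonality `x ⊣ y` in the norm with unit ball `K`. -/
def BirkhoffOrth (K : Set Plane) (x y : Plane) : Prop :=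
  x ≠ 0 ∧ y ≠ 0 ∧ ∀ t : ℝ, gauge K x ≤ gauge K (x + t • y)

/-- The set `A(K)` of Auerbach points. -/
def auerbachSet (K : Set Plane) : Set Plane :=
  {x | x ∈ frontier K ∧ ∃ y ∈ frontier K, BirkhoffOrth K x y ∧ BirkhoffOrth K y x}

/-- `C` is a closed (simple) arc with end points `x` and `y`. -/
def IsClosedArc (C : Set Plane) (x y : Plane) : Prop :=
  ∃ γ : ℝ → Plane, ContinuousOn γ (Set.Icc 0 1) ∧ Set.InjOn γ (Set.Icc 0 1) ∧
    γ 0 = x ∧ γ 1 = y ∧ γ '' Set.Icc 0 1 = C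

/-- An angular measure on `bd K`; a Borel measure on the closed set `bd K` is represented as
a Borel measure on the plane that vanishes outside `bd K`. -/
structure IsAngularMeasure (K : Set Plane) (μ : Measure Plane) : Prop where
  outside : μ (frontier K)ᶜ = 0
  total : μ (frontier K) = ENNReal.ofReal (2 * Real.pi)
  symmetric : ∀ X : Set Plane, X ⊆ frontier K → MeasurableSet X → μ X = μ (-X)
  continuous : ∀ x ∈ frontier K, μ {x} = 0

/-- A B-measure: arcs of `bd K` without opposite points that connect `x` to `y` with `x ⊣ y`
have measure `π / 2`. -/
structure IsBMeasure (K : Set Plane) (μ : Measure Plane) : Prop where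
  angular : IsAngularMeasure K μ
  arc : ∀ (C : Set Plane) (x y : Plane), C ⊆ frontier K → IsClosedArc C x y →
    (∀ z ∈ C, -z ∉ C) → BirkhoffOrth K x y → μ C = ENNReal.ofReal (Real.pi / 2)

/-- The point of the Euclidean unit circle with polar angle `φ`. -/
def circlePoint (φ : ℝ) : Plane := !₂[Real.cos φ, Real.sin φ]

/-- The affine map of `[0, 1]` onto the interval of polar angles `[-3π/8, 3π/8]`. -/
def arcAngle (t : ℝ) : ℝ := -(3 * Real.pi / 8) + 3 * Real.pi / 4 * t

/-- The Cantor set in the circular arc of polar angles `[-3π/8, 3π/8]`: the image of the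
ternary Cantor set when the arc is parametrized proportionally to arc length. -/
def cantorArc : Set Plane := (fun t => circlePoint (arcAngle t)) '' cantorSet

/-- `(u, v)` is one of the open intervals removed from `[0, 1]` to form the Cantor set. -/
def IsCantorGap (u v : ℝ) : Prop :=
  u < v ∧ u ∈ cantorSet ∧ v ∈ cantorSet ∧ ∀ t ∈ Set.Ioo u v, t ∉ cantorSet

/-- The bump function. -/
def bump (x : ℝ) : ℝ := if |x| < 1 then Real.exp (-(1 / (1 - x ^ 2))) else 0

/-- `ρ` is the polar radius of the unit circle in which every removed arc of the Cantor set
`cantorArc`, and its opposite, is replaced by a bump-perturbed arc. -/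
structure IsCantorBumpRadius (ρ : ℝ → ℝ) : Prop where
  pos : ∀ φ, 0 < ρ φ
  periodic : ∀ φ, ρ (φ + Real.pi) = ρ φ
  on_cantor : ∀ t ∈ cantorSet, ρ (arcAngle t) = 1
  on_gap : ∀ u v : ℝ, IsCantorGap u v → ∃ ε : ℝ, 0 < ε ∧
    ∀ φ ∈ Set.Icc (arcAngle u) (arcAngle v),
      ρ φ = 1 - ε * bump (2 / (arcAngle v - arcAngle u) * (φ - (arcAngle u + arcAngle v) / 2))
  on_rest : ∀ φ ∈ Set.Icc (3 * Real.pi / 8) (5 * Real.pi / 8), ρ φ = 1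

end NormedPlane

end

open NormedPlane

namespace NormedPlane

/-! ### The ternary Cantor set and its gaps -/

/-! Write the boundary in polar form as `r = 1 - H`, where `H` is a positive combination of the
bumps in the Cantor gaps, extended with period `π`. Coefficients that decay fast enough make `H`
smooth and C²-small (`exists_contDiff_tsum`, `exists_isDepth`). For `u = 1 / (1 - H)` this gives `u
+ u'' > 0`, so every tangent line touches the curve at one point only and leaves the rest on one
side (`supportForm_lt`). Hence the intersection of the tangent half-planes is a smooth, strictly
convex body with gauge `r * u s` in polar coordinates.

Let `tilt u s = arctan (u' / u)` and `turn u s = s + π/2 + tilt u s`, the angle of the tangent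
direction. Then the point at angle `s` is Birkhoff orthogonal to the point at angle `t` iff `t =
turn u s` modulo `π`, and `turn` is strictly increasing. The point at `s` is an Auerbach point iff
`turn (turn s) = s + π`, that is, iff `tilt s + tilt (turn s) = 0`
(`polarCurve_mem_auerbachSet_iff`).

The arc has length `3π/4`, so translating the Cantor parameter by `2/3` is a quarter turn. Modulo
`π`, a quarter turn therefore maps Cantor angles to Cantor angles and every gap to another gap,
except for the middle gap, which it exchanges with the unperturbed arc. At Cantor angles both tilts
vanish. In a gap the tilt is positive before the midpoint and negative after it, and the
quarter-turned gap has weakly the same signs. Monotonicity of `turn` keeps the tangent direction on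
the same side of the midpoint, so the two tilts cannot cancel and only the midpoint is an Auerbach
point. The same comparison leaves only `π/2` on the unperturbed arc.

For the B-measure, put an atomless probability measure on the left third of the Cantor set, add its
rotations by multiples of `π/2`, and scale by `π/2`. On these points `turn` is exactly the quarter
turn, so by monotonicity the arc from `s` to `turn s` contains, for almost every parameter, exactly
one of the four rotated points (`quarterMeasure_image_Icc`). -/

theorem one_mem_cantorSet : (1 : ℝ) ∈ cantorSet := by
  refine Set.mem_iInter.2 fun n => ?_
  induction n with
  | zero => simp
  | succ n ih => exact Or.inr ⟨1, ih, by norm_num⟩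

theorem div_three_mem_cantorSet {t : ℝ} (h : t ∈ cantorSet) : t / 3 ∈ cantorSet := by
  rw [cantorSet_eq_union_halves]
  exact Or.inl ⟨t, h, rfl⟩

theorem two_add_div_three_mem_cantorSet {t : ℝ} (h : t ∈ cantorSet) : (2 + t) / 3 ∈ cantorSet := by
  rw [cantorSet_eq_union_halves]
  exact Or.inr ⟨t, h, rfl⟩

theorem mem_cantorSet_cases {t : ℝ} (h : t ∈ cantorSet) :
    (t ≤ 1 / 3 ∧ 3 * t ∈ cantorSet) ∨ (2 / 3 ≤ t ∧ 3 * t - 2 ∈ cantorSet) := by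
  rw [cantorSet_eq_union_halves] at h
  rcases h with ⟨s, hs, rfl⟩ | ⟨s, hs, rfl⟩
  · have := cantorSet_subset_unitInterval hs
    refine Or.inl ⟨by simp only; linarith [this.2], ?_⟩
    convert hs using 1; ring
  · have := cantorSet_subset_unitInterval hs
    refine Or.inr ⟨by simp only; linarith [this.1], ?_⟩
    convert hs using 1; ring

theorem three_mul_mem_cantorSet {t : ℝ} (h : t ∈ cantorSet) (ht : t < 2 / 3) :
    3 * t ∈ cantorSet := by
  rcases mem_cantorSet_cases h with h | h
  · exact h.2
  · linarith [h.1]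

/-- The right third of the Cantor set is the left third moved by `2/3`. Under `arcAngle` this
translation is the rotation by `π/2`, the source of all coincidences between the Cantor set and
Birkhoff orthogonality. -/
theorem add_two_thirds_mem_cantorSet {t : ℝ} (h : t ∈ cantorSet) (ht : t < 2 / 3) :
    t + 2 / 3 ∈ cantorSet := by
  have := two_add_div_three_mem_cantorSet (three_mul_mem_cantorSet h ht)
  convert this using 1; ring

theorem sub_two_thirds_mem_cantorSet {t : ℝ} (h : t ∈ cantorSet) (ht : 1 / 3 < t) :
    t - 2 / 3 ∈ cantorSet := by
  rcases mem_cantorSet_cases h with h | h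
  · linarith [h.1]
  · have := div_three_mem_cantorSet h.2
    convert this using 1; ring

theorem IsCantorGap.nonneg {u v : ℝ} (h : IsCantorGap u v) : 0 ≤ u :=
  (cantorSet_subset_unitInterval h.2.1).1

theorem IsCantorGap.le_one {u v : ℝ} (h : IsCantorGap u v) : v ≤ 1 :=
  (cantorSet_subset_unitInterval h.2.2.1).2

theorem isCantorGap_middle : IsCantorGap (1 / 3) (2 / 3) := by
  refine ⟨by norm_num, ?_, ?_, fun t ht h => ?_⟩
  · exact div_three_mem_cantorSet one_mem_cantorSet
  · convert two_add_div_three_mem_cantorSet zero_mem_cantorSet using 1; norm_num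
  · rcases mem_cantorSet_cases h with h | h
    · linarith [h.1, ht.1]
    · linarith [h.1, ht.2]

theorem IsCantorGap.div_three {u v : ℝ} (h : IsCantorGap u v) : IsCantorGap (u / 3) (v / 3) := by
  refine ⟨by linarith [h.1], div_three_mem_cantorSet h.2.1, div_three_mem_cantorSet h.2.2.1,
    fun t ht hC => ?_⟩
  refine h.2.2.2 (3 * t) ⟨by linarith [ht.1], by linarith [ht.2]⟩ (three_mul_mem_cantorSet hC ?_)
  linarith [ht.2, h.le_one]

/-- Two gaps with a common point coincide. -/
theorem IsCantorGap.eq_of_mem {u v u' v' t : ℝ} (h : IsCantorGap u v) (h' : IsCantorGap u' v')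
    (ht : t ∈ Set.Ioo u v) (ht' : t ∈ Set.Ioo u' v') : u = u' ∧ v = v' := by
  constructor
  · refine le_antisymm ?_ ?_ <;> by_contra! hlt
    · exact h'.2.2.2 u ⟨hlt, ht.1.trans ht'.2⟩ h.2.1
    · exact h.2.2.2 u' ⟨hlt, ht'.1.trans ht.2⟩ h'.2.1
  · refine le_antisymm ?_ ?_ <;> by_contra! hlt
    · exact h.2.2.2 v' ⟨ht.1.trans ht'.2, hlt⟩ h'.2.2.1
    · exact h'.2.2.2 v ⟨ht'.1.trans ht.2, hlt⟩ h.2.2.1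

/-- Every point of `[0, 1]` outside of the Cantor set lies in a gap. -/
theorem exists_isCantorGap {t : ℝ} (h0 : 0 ≤ t) (h1 : t ≤ 1) (ht : t ∉ cantorSet) :
    ∃ u v, IsCantorGap u v ∧ t ∈ Set.Ioo u v := by
  have hA : IsCompact (cantorSet ∩ Set.Iic t) := isCompact_cantorSet.inter_right isClosed_Iic
  have hB : IsCompact (cantorSet ∩ Set.Ici t) := isCompact_cantorSet.inter_right isClosed_Ici
  obtain ⟨u, hu, hu'⟩ := hA.exists_isGreatest ⟨0, zero_mem_cantorSet, h0⟩
  obtain ⟨v, hv, hv'⟩ := hB.exists_isLeast ⟨1, one_mem_cantorSet, h1⟩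
  have hut : u < t := lt_of_le_of_ne hu.2 fun h => ht (h ▸ hu.1)
  have htv : t < v := lt_of_le_of_ne hv.2 fun h => ht (h ▸ hv.1)
  refine ⟨u, v, ⟨hut.trans htv, hu.1, hv.1, fun s hs hC => ?_⟩, hut, htv⟩
  rcases le_total s t with hst | hst
  · exact absurd (hu' ⟨hC, hst⟩) (not_le.2 hs.1)
  · exact absurd (hv' ⟨hC, hst⟩) (not_le.2 hs.2)

/-- A gap is the middle one, or its translate by `2 / 3` to the right or to the left is a gap. -/
theorem IsCantorGap.translate {u v : ℝ} (h : IsCantorGap u v) :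
    (u = 1 / 3 ∧ v = 2 / 3) ∨ (v ≤ 1 / 3 ∧ IsCantorGap (u + 2 / 3) (v + 2 / 3)) ∨
      (2 / 3 ≤ u ∧ IsCantorGap (u - 2 / 3) (v - 2 / 3)) := by
  rcases mem_cantorSet_cases h.2.2.1 with ⟨hv, -⟩ | ⟨hv, -⟩
  · refine Or.inr (Or.inl ⟨hv, by linarith [h.1],
      add_two_thirds_mem_cantorSet h.2.1 (by linarith [h.1]),
      add_two_thirds_mem_cantorSet h.2.2.1 (by linarith), fun t ht hC => ?_⟩)
    exact h.2.2.2 (t - 2 / 3) ⟨by linarith [ht.1], by linarith [ht.2]⟩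
      (sub_two_thirds_mem_cantorSet hC (by linarith [ht.1, h.nonneg]))
  rcases mem_cantorSet_cases h.2.1 with ⟨hu, -⟩ | ⟨hu, -⟩
  -- A gap that starts in the left third and ends in the right third contains `1/2`, as the middle
  -- gap does.
  · refine Or.inl (h.eq_of_mem isCantorGap_middle (t := 1 / 2) ?_ ?_) <;>
      constructor <;> linarith
  · refine Or.inr (Or.inr ⟨hu, by linarith [h.1],
      sub_two_thirds_mem_cantorSet h.2.1 (by linarith),
      sub_two_thirds_mem_cantorSet h.2.2.1 (by linarith), fun t ht hC => ?_⟩)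
    exact h.2.2.2 (t + 2 / 3) ⟨by linarith [ht.1], by linarith [ht.2]⟩
      (add_two_thirds_mem_cantorSet hC (by linarith [ht.2, h.le_one]))

/-- The type of gaps of the Cantor set. -/
abbrev CantorGap : Type := {p : ℝ × ℝ // IsCantorGap p.1 p.2}

instance : Countable CantorGap := by
  refine Pairwise.countable_of_isOpen_disjoint (s := fun i : CantorGap => Set.Ioo i.1.1 i.1.2)
    (fun i j hij => Set.disjoint_left.2 fun t hi hj => hij ?_) (fun _ => isOpen_Ioo)
    (fun i => Set.nonempty_Ioo.2 i.2.1)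
  obtain ⟨h1, h2⟩ := i.2.eq_of_mem j.2 hi hj
  exact Subtype.ext (Prod.ext h1 h2)

instance : Infinite CantorGap := by
  have key : ∀ n : ℕ, IsCantorGap ((1 / 3) / 3 ^ n) ((2 / 3) / 3 ^ n) := by
    intro n
    induction n with
    | zero => simpa using isCantorGap_middle
    | succ n ih => convert ih.div_three using 1 <;> (rw [pow_succ]; ring)
  refine Infinite.of_injective (fun n : ℕ => (⟨(_, _), key n⟩ : CantorGap)) fun m n hmn => ?_
  have h : ((1 / 3 : ℝ)) / 3 ^ m = (1 / 3) / 3 ^ n := congrArg (fun i : CantorGap => i.1.1) hmn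
  have h3 : (3 : ℝ) ^ m = 3 ^ n := by
    field_simp at h
    exact h.symm
  exact pow_right_injective₀ (by norm_num) (by norm_num) h3

/-- By self-similarity the Cantor set is the union of two copies scaled by `1/3`, so its finite
volume `m` satisfies `m ≤ (2/3) m`. -/
theorem volume_cantorSet : volume cantorSet = 0 := by
  have hfin : volume cantorSet ≠ ⊤ := isCompact_cantorSet.measure_lt_top.ne
  have h1 : volume ((· / 3) '' cantorSet) = ENNReal.ofReal (1 / 3) * volume cantorSet := by
    have : (fun x : ℝ => x / 3) '' cantorSet = (1 / 3 : ℝ) • cantorSet := by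
      ext x; simp [Set.mem_smul_set, div_eq_inv_mul]
    rw [this, Measure.addHaar_smul]
    norm_num
  have h2 : volume ((fun x => (2 + x) / 3) '' cantorSet)
      = ENNReal.ofReal (1 / 3) * volume cantorSet := by
    have : (fun x : ℝ => (2 + x) / 3) '' cantorSet
        = (fun x => 2 / 3 + x) '' ((1 / 3 : ℝ) • cantorSet) := by
      ext x
      simp only [Set.mem_image, Set.mem_smul_set, smul_eq_mul, exists_exists_and_eq_and]
      refine exists_congr fun a => and_congr_right fun _ => ?_
      rw [show (2 + a) / 3 = 2 / 3 + 1 / 3 * a by ring]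
    rw [this, Set.image_add_left, measure_preimage_add, Measure.addHaar_smul]
    norm_num
  have h3 : volume cantorSet ≤ ENNReal.ofReal (2 / 3) * volume cantorSet := by
    calc volume cantorSet
        = volume ((· / 3) '' cantorSet ∪ (fun x => (2 + x) / 3) '' cantorSet) := by
          rw [← cantorSet_eq_union_halves]
      _ ≤ ENNReal.ofReal (1 / 3) * volume cantorSet + ENNReal.ofReal (1 / 3) * volume cantorSet :=
          (measure_union_le _ _).trans (by rw [h1, h2])
      _ = ENNReal.ofReal (2 / 3) * volume cantorSet := by
          rw [← add_mul, ← ENNReal.ofReal_add (by norm_num) (by norm_num)]; norm_num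
  have h4 := ENNReal.toReal_mono (ENNReal.mul_ne_top ENNReal.ofReal_ne_top hfin) h3
  rw [ENNReal.toReal_mul, ENNReal.toReal_ofReal (by norm_num)] at h4
  have h5 : (volume cantorSet).toReal = 0 := by
    linarith [ENNReal.toReal_nonneg (a := volume cantorSet)]
  exact ((ENNReal.toReal_eq_zero_iff _).1 h5).resolve_right hfin

/-- The Cantor set carries an atomless probability measure. -/
theorem exists_probabilityMeasure_cantorSet :
    ∃ ν : Measure ℝ, IsProbabilityMeasure ν ∧ NullSingletonClass ν ∧ ν cantorSetᶜ = 0 := by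
  have hC : MeasurableSet cantorSet := isClosed_cantorSet.measurableSet
  have : StandardBorelSpace cantorSet := hC.standardBorel
  have h' : Cardinal.mk (ℕ → Bool) = 2 ^ Cardinal.aleph0 := by simp
  have hunc : ¬ Countable cantorSet := by
    intro h
    have : Countable (ℕ → Bool) := cantorSetHomeomorphNatToBool.symm.injective.countable
    have h := Cardinal.mk_le_aleph0_iff.2 this
    exact absurd (h' ▸ h) (not_le.2 (Cardinal.cantor _))
  have hunc' : ¬ Countable (Set.Icc (0 : ℝ) 1) := by
    intro h
    have := (Set.countable_coe_iff.1 h).measure_zero volume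
    simp at this
  -- Uncountable standard Borel spaces are isomorphic, so Lebesgue measure on `[0, 1]` can be
  -- transported to the Cantor set; injectivity keeps it atomless.
  let e := PolishSpace.measurableEquivOfNotCountable hunc' hunc
  let f : Set.Icc (0 : ℝ) 1 → ℝ := fun t => (e t : ℝ)
  have hf : MeasurableEmbedding f := (MeasurableEmbedding.subtype_coe hC).comp e.measurableEmbedding
  refine ⟨Measure.map f volume, Measure.isProbabilityMeasure_map hf.measurable.aemeasurable,
    ⟨fun x => ?_⟩, ?_⟩
  · rw [hf.map_apply]
    exact (Set.subsingleton_singleton.preimage hf.injective).measure_zero volume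
  · rw [hf.map_apply]
    have : f ⁻¹' cantorSetᶜ = ∅ := by
      ext t; simp [f]
    rw [this, measure_empty]

/-! ### Smooth series of bump functions -/

theorem bump_eq_expNegInvGlue (x : ℝ) : bump x = expNegInvGlue (1 - x ^ 2) := by
  unfold bump expNegInvGlue
  by_cases h : |x| < 1
  · have h' : 0 < 1 - x ^ 2 := by have := (sq_lt_one_iff_abs_lt_one x).2 h; linarith
    rw [if_pos h, if_neg (not_le.2 h'), one_div]
  · have h' : 1 - x ^ 2 ≤ 0 := by
      have := mt (sq_lt_one_iff_abs_lt_one x).1 h; linarith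
    rw [if_neg h, if_pos h']

theorem contDiff_bump : ContDiff ℝ ∞ bump := by
  rw [show bump = fun x => expNegInvGlue (1 - x ^ 2) from funext bump_eq_expNegInvGlue]
  exact expNegInvGlue.contDiff.comp (contDiff_const.sub (contDiff_id.pow 2))

theorem bump_nonneg (x : ℝ) : 0 ≤ bump x := by
  rw [bump_eq_expNegInvGlue]
  exact expNegInvGlue.nonneg _

theorem bump_eq_zero {x : ℝ} (h : 1 ≤ |x|) : bump x = 0 := if_neg (not_lt.2 h)

theorem hasDerivAt_bump {x : ℝ} (h : |x| < 1) :
    HasDerivAt bump (-(2 * x / (1 - x ^ 2) ^ 2) * bump x) x := by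
  have hx : 1 - x ^ 2 ≠ 0 := by have := (sq_lt_one_iff_abs_lt_one x).2 h; linarith
  have h1 : HasDerivAt (fun y : ℝ => 1 - y ^ 2) (-(2 * x)) x := by
    simpa using (hasDerivAt_pow 2 x).const_sub 1
  have h2 := ((h1.inv hx).neg).exp
  have h3 : bump =ᶠ[nhds x] fun y : ℝ => Real.exp (-(1 - y ^ 2)⁻¹) := by
    filter_upwards [(isOpen_lt continuous_abs continuous_const).mem_nhds h] with y hy
    exact (if_pos hy).trans (by rw [one_div])
  refine (h2.congr_of_eventuallyEq h3).congr_deriv ?_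
  rw [bump, if_pos h, one_div]
  simp only [Pi.neg_apply, Pi.inv_apply]
  ring

theorem deriv_bump_pos {x : ℝ} (h : -1 < x) (h0 : x < 0) : 0 < deriv bump x := by
  have h1 : |x| < 1 := abs_lt.2 ⟨h, by linarith⟩
  have hx : 0 < 1 - x ^ 2 := by have := (sq_lt_one_iff_abs_lt_one x).2 h1; linarith
  rw [(hasDerivAt_bump h1).deriv]
  refine mul_pos ?_ (by rw [bump, if_pos h1]; exact Real.exp_pos _)
  rw [← neg_div]
  exact div_pos (by linarith) (by positivity)

theorem deriv_bump_neg {x : ℝ} (h0 : 0 < x) (h : x < 1) : deriv bump x < 0 := by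
  have h1 : |x| < 1 := abs_lt.2 ⟨by linarith, h⟩
  have hx : 0 < 1 - x ^ 2 := by have := (sq_lt_one_iff_abs_lt_one x).2 h1; linarith
  rw [(hasDerivAt_bump h1).deriv]
  refine mul_neg_of_neg_of_pos ?_ (by rw [bump, if_pos h1]; exact Real.exp_pos _)
  exact neg_neg_of_pos (div_pos (by linarith) (by positivity))

theorem deriv_bump_zero : deriv bump 0 = 0 := by
  rw [(hasDerivAt_bump (by simp)).deriv]; simp

/-- Countably many smooth compactly supported functions have a smooth positive combination that is
small together with its first derivatives. -/
theorem exists_contDiff_tsum {ι : Type*} [Countable ι] (g : ι → ℝ → ℝ)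
    (hg : ∀ i, ContDiff ℝ ∞ (g i)) (hc : ∀ i, HasCompactSupport (g i)) (N : ℕ) {δ : ℝ}
    (hδ : 0 < δ) :
    ∃ ε : ι → ℝ, (∀ i, 0 < ε i) ∧ ContDiff ℝ ∞ (fun x => ∑' i, ε i * g i x) ∧
      ∀ k ≤ N, ∀ x, |iteratedDeriv k (fun x => ∑' i, ε i * g i x) x| ≤ δ := by
  classical
  have := Encodable.ofCountable ι
  have hM : ∀ i k, ∃ M : ℝ, ∀ x, ‖iteratedFDeriv ℝ k (g i) x‖ ≤ M := fun i k => by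
    obtain ⟨M, hM⟩ := ((hc i).iteratedFDeriv k).exists_bound_of_continuous
      ((hg i).continuous_iteratedFDeriv (by exact_mod_cast le_top))
    exact ⟨M, hM⟩
  choose M hM using hM
  have hM0 : ∀ i k, 0 ≤ M i k := fun i k => (norm_nonneg _).trans (hM i k 0)
  let c : ι → ℝ := fun i => (1 / 2) ^ Encodable.encode i
  have hcsum : Summable c := summable_geometric_two_encode
  have hc0 : ∀ i, 0 < c i := fun i => by positivity
  have hc2 : ∑' i, c i ≤ 2 := by
    rw [← tsum_geometric_two]
    exact hcsum.tsum_le_tsum_of_inj Encodable.encode Encodable.encode_injective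
      (fun _ _ => by positivity) (fun _ => le_rfl) summable_geometric_two
  -- The number of derivative bounds absorbed into the normalizer grows with the index. Each order
  -- `k` is thus controlled for all but finitely many `i`, which suffices for summability, and each
  -- order `k ≤ N` for every `i`, which gives the bound by `δ`.
  let S : ι → ℝ := fun i => 1 + ∑ k ∈ Finset.range (Encodable.encode i + N + 1), M i k
  have hS1 : ∀ i, 0 < S i := fun i => by
    have : 0 ≤ ∑ k ∈ Finset.range (Encodable.encode i + N + 1), M i k :=
      Finset.sum_nonneg fun k _ => hM0 i k
    simp only [S]; linarith
  -- The factor `δ / 2` compensates for the weights `c i`, whose sum is at most `2`.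
  let ε : ι → ℝ := fun i => δ / 2 * c i / S i
  have hε : ∀ i, 0 < ε i := fun i => by have := hS1 i; have := hc0 i; positivity
  have hle : ∀ i k, k ≤ Encodable.encode i + N → ε i * M i k ≤ δ / 2 * c i := by
    intro i k hk
    have h1 : M i k ≤ S i := by
      have : M i k ≤ ∑ k ∈ Finset.range (Encodable.encode i + N + 1), M i k :=
        Finset.single_le_sum (f := M i) (fun k _ => hM0 i k) (Finset.mem_range.2 (by omega))
      simp only [S]; linarith
    calc ε i * M i k = δ / 2 * c i * (M i k / S i) := by simp only [ε]; ring
      _ ≤ δ / 2 * c i * 1 := by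
          have := hc0 i
          gcongr
          exact (div_le_one (hS1 i)).2 h1
      _ = _ := mul_one _
  have hsum : ∀ k, Summable fun i => ε i * M i k := by
    intro k
    refine Summable.of_norm_bounded_eventually (hcsum.mul_left (δ / 2)) ?_
    have hfin : {i : ι | Encodable.encode i < k}.Finite :=
      (Set.finite_lt_nat k).preimage Encodable.encode_injective.injOn
    filter_upwards [hfin.compl_mem_cofinite] with i hi
    have hi' : k ≤ Encodable.encode i := not_lt.1 hi
    rw [Real.norm_of_nonneg (mul_nonneg (hε i).le (hM0 i k))]
    exact hle i k (by omega)
  have hf : ∀ i, ContDiff ℝ ∞ fun x => ε i * g i x := fun i => contDiff_const.mul (hg i)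
  have hbound : ∀ (k : ℕ) (i : ι) (x : ℝ), ‖iteratedFDeriv ℝ k (fun x => ε i * g i x) x‖
      ≤ ε i * M i k := by
    intro k i x
    have h : iteratedFDeriv ℝ k (fun x => ε i * g i x) x = ε i • iteratedFDeriv ℝ k (g i) x :=
      iteratedFDeriv_const_smul_apply (a := ε i) (f := g i)
        ((hg i).of_le (by exact_mod_cast le_top)).contDiffAt
    rw [h, norm_smul, Real.norm_of_nonneg (hε i).le]
    gcongr
    · exact (hε i).le
    · exact hM i k x
  refine ⟨ε, hε, contDiff_tsum (N := ⊤) hf (fun k _ => hsum k) fun k i x _ => hbound k i x, ?_⟩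
  intro k hk x
  rw [← Real.norm_eq_abs, ← norm_iteratedFDeriv_eq_norm_iteratedDeriv,
    iteratedFDeriv_tsum_apply (N := ⊤) hf (fun k _ => hsum k) (fun k i x _ => hbound k i x) le_top]
  refine (tsum_of_norm_bounded (hsum k).hasSum fun i => hbound k i x).trans ?_
  calc ∑' i, ε i * M i k ≤ ∑' i, δ / 2 * c i :=
        (hsum k).tsum_le_tsum (fun i => hle i k (by omega)) (hcsum.mul_left _)
    _ = δ / 2 * ∑' i, c i := tsum_mul_left
    _ ≤ δ / 2 * 2 := by gcongr
    _ = δ := by ring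

theorem arcAngle_strictMono : StrictMono arcAngle := fun s t h => by
  unfold arcAngle
  have := Real.pi_pos
  gcongr

/-- There are positive multiples of the bump functions of the gaps, transported to the angles, whose
sum is smooth and small in the `C²` sense. -/
theorem exists_contDiff_gapBumps :
    ∃ h : ℝ → ℝ, ContDiff ℝ ∞ h ∧ (∀ x, 0 ≤ h x) ∧ (∀ x, h x ≤ 1 / 4) ∧
      (∀ x, |deriv (deriv h) x| ≤ 1 / 4) ∧
      (∀ x, (∀ u v, IsCantorGap u v → x ∉ Set.Ioo (arcAngle u) (arcAngle v)) → h x = 0) ∧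
      ∀ u v : ℝ, IsCantorGap u v → ∃ ε : ℝ, 0 < ε ∧
        ∀ φ ∈ Set.Icc (arcAngle u) (arcAngle v), h φ =
          ε * bump (2 / (arcAngle v - arcAngle u) * (φ - (arcAngle u + arcAngle v) / 2)) := by
  let g : CantorGap → ℝ → ℝ := fun i φ =>
    bump (2 / (arcAngle i.1.2 - arcAngle i.1.1) * (φ - (arcAngle i.1.1 + arcAngle i.1.2) / 2))
  have hpos : ∀ i : CantorGap, 0 < arcAngle i.1.2 - arcAngle i.1.1 := fun i =>
    sub_pos.2 (arcAngle_strictMono i.2.1)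
  have hzero : ∀ (i : CantorGap) (x : ℝ), x ∉ Set.Ioo (arcAngle i.1.1) (arcAngle i.1.2) →
      g i x = 0 := by
    intro i x hx
    refine bump_eq_zero ?_
    by_contra! hlt
    rw [abs_lt, div_mul_eq_mul_div, lt_div_iff₀ (hpos i), div_lt_iff₀ (hpos i)] at hlt
    exact hx ⟨by linarith [hlt.1], by linarith [hlt.2]⟩
  -- Order `2` suffices, because convexity of the polar curve involves only two derivatives.
  obtain ⟨ε, hε, hs, hb⟩ := exists_contDiff_tsum g
    (fun i => contDiff_bump.comp (contDiff_const.mul (contDiff_id.sub contDiff_const)))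
    (fun i => HasCompactSupport.intro
      (isCompact_Icc (a := arcAngle i.1.1) (b := arcAngle i.1.2))
      fun x hx => hzero i x fun h => hx ⟨h.1.le, h.2.le⟩) 2 (δ := 1 / 4) (by norm_num)
  refine ⟨_, hs, fun x => tsum_nonneg fun i => mul_nonneg (hε i).le (bump_nonneg _),
    fun x => ?_, fun x => ?_, fun x hx => ?_, fun u v huv => ⟨ε ⟨(u, v), huv⟩, hε _, ?_⟩⟩
  · simpa using (le_abs_self _).trans (hb 0 (by norm_num) x)
  · simpa [iteratedDeriv_succ, iteratedDeriv_zero] using hb 2 le_rfl x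
  · rw [← tsum_zero (α := ℝ) (β := CantorGap)]
    exact tsum_congr fun i => by rw [hzero i x (hx _ _ i.2), mul_zero]
  · intro φ hφ
    refine tsum_eq_single (f := fun i => ε i * g i φ) (⟨(u, v), huv⟩ : CantorGap) fun i hi => ?_
    rw [hzero i φ fun hφi => hi ?_, mul_zero]
    by_contra hne
    -- Here `φ` may be an end point of its closed gap. It is interior to the other gap, so the two
    -- open gaps still overlap and must coincide.
    have hlt : max (arcAngle u) (arcAngle i.1.1) < min (arcAngle v) (arcAngle i.1.2) := by
      have h1 : arcAngle u < arcAngle v := arcAngle_strictMono huv.1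
      have h2 : arcAngle i.1.1 < arcAngle i.1.2 := arcAngle_strictMono i.2.1
      rw [max_lt_iff, lt_min_iff, lt_min_iff]
      exact ⟨⟨h1, hφ.1.trans_lt hφi.2⟩, hφi.1.trans_le hφ.2, h2⟩
    rw [← arcAngle_strictMono.monotone.map_max, ← arcAngle_strictMono.monotone.map_min] at hlt
    obtain ⟨t, ht1, ht2⟩ := exists_between (arcAngle_strictMono.lt_iff_lt.1 hlt)
    rw [max_lt_iff] at ht1
    rw [lt_min_iff] at ht2
    obtain ⟨h1, h2⟩ := i.2.eq_of_mem huv ⟨ht1.2, ht2.2⟩ ⟨ht1.1, ht2.1⟩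
    exact hne (Subtype.ext (Prod.ext h1 h2))

/-! ### Periodic extension and existence of the depth function -/

theorem abs_sub_round_mul_pi_le (x : ℝ) : |x - round (x / Real.pi) * Real.pi| ≤ Real.pi / 2 := by
  have h := abs_sub_round (x / Real.pi)
  have hp := Real.pi_pos
  have : x - round (x / Real.pi) * Real.pi = (x / Real.pi - round (x / Real.pi)) * Real.pi := by
    field_simp
  rw [this, abs_mul, abs_of_pos hp]
  nlinarith

/-- The `π`-periodic extension of a function supported in `[-3π/8, 3π/8]`. -/
theorem exists_periodic_extension (h : ℝ → ℝ) (h0 : ∀ x, 3 * Real.pi / 8 ≤ |x| → h x = 0) :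
    ∃ H : ℝ → ℝ, (∀ x, H (x + Real.pi) = H x) ∧
      ∀ (k : ℤ) (x : ℝ), |x - k * Real.pi| ≤ 5 * Real.pi / 8 → H x = h (x - k * Real.pi) := by
  have hp := Real.pi_pos
  refine ⟨fun x => h (x - round (x / Real.pi) * Real.pi), fun x => ?_, fun k x hk => ?_⟩
  · have : (x + Real.pi) / Real.pi = x / Real.pi + 1 := by field_simp
    simp only [this, round_add_one, Int.cast_add, Int.cast_one]
    congr 1; ring
  · simp only
    have hr := abs_sub_round_mul_pi_le x
    generalize round (x / Real.pi) = j at hr ⊢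
    rcases eq_or_ne j k with rfl | hjk
    · rfl
    -- For different translates the two offsets are at least `π` apart. One is at most `π/2` and the
    -- other at most `5π/8` in absolute value, so both are at least `3π/8`, where `h` vanishes.
    have h1 : Real.pi ≤ |(x - k * Real.pi) - (x - j * Real.pi)| := by
      have : (x - k * Real.pi) - (x - j * Real.pi) = ((j - k : ℤ) : ℝ) * Real.pi := by
        push_cast; ring
      rw [this, abs_mul, abs_of_pos hp]
      have h2 : (1 : ℝ) ≤ |((j - k : ℤ) : ℝ)| := by
        exact_mod_cast Int.one_le_abs (sub_ne_zero.2 hjk)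
      nlinarith
    have h3 := abs_sub (x - k * Real.pi) (x - j * Real.pi)
    rw [h0 (x - j * Real.pi) (by linarith), h0 (x - k * Real.pi) (by linarith)]

/-- The depth `H = 1 - ρ` of the perturbation of the unit circle, as a function of the angle. -/
structure IsDepth (H : ℝ → ℝ) : Prop where
  contDiff : ContDiff ℝ ∞ H
  periodic : ∀ x, H (x + Real.pi) = H x
  nonneg : ∀ x, 0 ≤ H x
  le : ∀ x, H x ≤ 1 / 4
  deriv2_le : ∀ x, |deriv (deriv H) x| ≤ 1 / 4
  on_cantor : ∀ t ∈ cantorSet, H (arcAngle t) = 0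
  on_gap : ∀ u v : ℝ, IsCantorGap u v → ∃ ε : ℝ, 0 < ε ∧
    ∀ φ ∈ Set.Icc (arcAngle u) (arcAngle v),
      H φ = ε * bump (2 / (arcAngle v - arcAngle u) * (φ - (arcAngle u + arcAngle v) / 2))
  on_rest : ∀ φ ∈ Set.Icc (3 * Real.pi / 8) (5 * Real.pi / 8), H φ = 0

theorem arcAngle_zero : arcAngle 0 = -(3 * Real.pi / 8) := by simp [arcAngle]

theorem arcAngle_one : arcAngle 1 = 3 * Real.pi / 8 := by unfold arcAngle; ring

theorem exists_isDepth : ∃ H, IsDepth H := by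
  have hp := Real.pi_pos
  obtain ⟨h, hs, hn, hle, hd, hz, hgap⟩ := exists_contDiff_gapBumps
  have hgapmem : ∀ {u v x : ℝ}, IsCantorGap u v → x ∈ Set.Icc (arcAngle u) (arcAngle v) →
      -(3 * Real.pi / 8) ≤ x ∧ x ≤ 3 * Real.pi / 8 := by
    intro u v x huv hx
    rw [← arcAngle_zero, ← arcAngle_one]
    exact ⟨(arcAngle_strictMono.monotone huv.nonneg).trans hx.1,
      hx.2.trans (arcAngle_strictMono.monotone huv.le_one)⟩
  have h0 : ∀ x, 3 * Real.pi / 8 ≤ |x| → h x = 0 := by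
    intro x hx
    refine hz x fun u v huv hxu => ?_
    have h1 := arcAngle_strictMono.monotone huv.nonneg
    have h2 := arcAngle_strictMono.monotone huv.le_one
    rw [arcAngle_zero] at h1
    rw [arcAngle_one] at h2
    exact absurd (abs_lt.2 ⟨h1.trans_lt hxu.1, hxu.2.trans_le h2⟩) (not_lt.2 hx)
  obtain ⟨H, hper, hH⟩ := exists_periodic_extension h h0
  have hH0 : ∀ x, |x| ≤ 5 * Real.pi / 8 → H x = h x := fun x hx => by
    simpa using hH 0 x (by simpa using hx)
  have hloc : ∀ x, ∃ c : ℝ, ∀ᶠ y in nhds x, H y = h (y - c) := by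
    intro x
    refine ⟨round (x / Real.pi) * Real.pi, ?_⟩
    -- The offset from the nearest multiple of `π` is at most `π/2`; the slack up to `5π/8` makes
    -- `H` a single translate of `h` on a whole neighbourhood.
    have hlt : |x - round (x / Real.pi) * Real.pi| < 5 * Real.pi / 8 :=
      (abs_sub_round_mul_pi_le x).trans_lt (by linarith)
    have hcont : Continuous fun y : ℝ => |y - round (x / Real.pi) * Real.pi| := by fun_prop
    filter_upwards [(isOpen_lt hcont continuous_const).mem_nhds hlt] with y hy
    exact hH _ y (le_of_lt hy)
  refine ⟨H, ?_, hper, fun x => ?_, fun x => ?_, fun x => ?_, fun t ht => ?_, fun u v huv => ?_,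
    fun φ hφ => ?_⟩
  · refine contDiff_iff_contDiffAt.2 fun x => ?_
    obtain ⟨c, hc⟩ := hloc x
    exact ((hs.comp (contDiff_id.sub contDiff_const)).contDiffAt).congr_of_eventuallyEq hc
  · obtain ⟨c, hc⟩ := hloc x
    rw [hc.self_of_nhds]; exact hn _
  · obtain ⟨c, hc⟩ := hloc x
    rw [hc.self_of_nhds]; exact hle _
  · obtain ⟨c, hc⟩ := hloc x
    have h1 : deriv H =ᶠ[nhds x] fun y => deriv h (y - c) := by
      filter_upwards [hc.eventually_nhds] with y hy
      rw [Filter.EventuallyEq.deriv_eq hy, deriv_comp_sub_const]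
    rw [h1.deriv_eq, deriv_comp_sub_const]
    exact hd _
  · have h01 := cantorSet_subset_unitInterval ht
    have h1 := arcAngle_strictMono.monotone h01.1
    have h2 := arcAngle_strictMono.monotone h01.2
    rw [arcAngle_zero] at h1
    rw [arcAngle_one] at h2
    rw [hH0 _ (abs_le.2 ⟨by linarith, by linarith⟩)]
    exact hz _ fun u v huv hmem => huv.2.2.2 t
      ⟨arcAngle_strictMono.lt_iff_lt.1 hmem.1, arcAngle_strictMono.lt_iff_lt.1 hmem.2⟩ ht
  · obtain ⟨ε, hε, hεh⟩ := hgap u v huv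
    refine ⟨ε, hε, fun φ hφ => ?_⟩
    have := hgapmem huv hφ
    rw [hH0 _ (abs_le.2 ⟨by linarith, by linarith⟩), hεh φ hφ]
  · rw [hH0 _ (abs_le.2 ⟨by linarith [hφ.1], by linarith [hφ.2]⟩)]
    exact h0 _ (hφ.1.trans (le_abs_self _))

/-! ### Planar bodies given by a polar gauge function -/

@[simp] theorem circlePoint_apply_zero (s : ℝ) : circlePoint s 0 = Real.cos s := rfl

@[simp] theorem circlePoint_apply_one (s : ℝ) : circlePoint s 1 = Real.sin s := rfl

theorem plane_ext {x y : Plane} (h0 : x 0 = y 0) (h1 : x 1 = y 1) : x = y := by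
  ext i
  fin_cases i
  · exact h0
  · exact h1

theorem exists_eq_smul_of_det_eq_zero {x v : Plane} (hv : v ≠ 0) (h : x 0 * v 1 - x 1 * v 0 = 0) :
    ∃ c : ℝ, x = c • v := by
  have hpos : v 0 ^ 2 + v 1 ^ 2 ≠ 0 := by
    intro h0
    refine hv (plane_ext ?_ ?_) <;> simp only [PiLp.zero_apply] <;> nlinarith
  refine ⟨(x 0 * v 0 + x 1 * v 1) / (v 0 ^ 2 + v 1 ^ 2), plane_ext ?_ ?_⟩ <;>
    simp only [PiLp.smul_apply, smul_eq_mul] <;> field_simp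
  · linear_combination v 1 * h
  · linear_combination -v 0 * h

theorem contDiff_circlePoint : ContDiff ℝ ∞ circlePoint := by
  rw [contDiff_euclidean]
  intro i
  fin_cases i
  · exact Real.contDiff_cos
  · exact Real.contDiff_sin

theorem circlePoint_eq_iff {s t : ℝ} :
    circlePoint s = circlePoint t ↔ ∃ k : ℤ, s = t + 2 * Real.pi * k := by
  constructor
  · intro h
    have h1 := Real.Angle.cos_sin_inj (congrArg (fun x : Plane => x 0) h)
      (congrArg (fun x : Plane => x 1) h)
    obtain ⟨k, hk⟩ := Real.Angle.angle_eq_iff_two_pi_dvd_sub.1 h1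
    exact ⟨k, by linarith⟩
  · rintro ⟨k, rfl⟩
    have : t + 2 * Real.pi * k = t + k * (2 * Real.pi) := by ring
    refine plane_ext ?_ ?_
    · simp only [circlePoint_apply_zero, this, Real.cos_add_int_mul_two_pi]
    · simp only [circlePoint_apply_one, this, Real.sin_add_int_mul_two_pi]

theorem circlePoint_add_pi (s : ℝ) : circlePoint (s + Real.pi) = -circlePoint s :=
  plane_ext (by simp) (by simp)

theorem norm_circlePoint (s : ℝ) : ‖circlePoint s‖ = 1 := by
  rw [EuclideanSpace.norm_eq]
  simp [Fin.sum_univ_two]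

theorem circlePoint_ne_zero (s : ℝ) : circlePoint s ≠ 0 := by
  rw [← norm_ne_zero_iff, norm_circlePoint]; exact one_ne_zero

theorem exists_eq_smul_circlePoint (x : Plane) : ∃ r s : ℝ, 0 ≤ r ∧ x = r • circlePoint s := by
  let z : ℂ := ⟨x 0, x 1⟩
  refine ⟨‖z‖, z.arg, norm_nonneg _, plane_ext ?_ ?_⟩
  · exact (Complex.norm_mul_cos_arg z).symm
  · exact (Complex.norm_mul_sin_arg z).symm

/-- The properties of `u = 1 / ρ` that make the curve with polar radius `ρ` the boundary of a
smooth and strictly convex symmetric body inside of the unit disc. -/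
structure IsGaugeProfile (u : ℝ → ℝ) : Prop where
  contDiff : ContDiff ℝ ∞ u
  periodic : ∀ s, u (s + Real.pi) = u s
  one_le : ∀ s, 1 ≤ u s
  curvature_pos : ∀ s, 0 < u s + deriv (deriv u) s

/-- The linear form that equals `1` on the tangent line at the boundary point of angle `s`. -/
noncomputable def supportForm (u : ℝ → ℝ) (s : ℝ) (x : Plane) : ℝ :=
  u s * (Real.cos s * x 0 + Real.sin s * x 1) + deriv u s * (Real.cos s * x 1 - Real.sin s * x 0)

/-- The body bounded by the curve with polar radius `1 / u`, as an intersection of half-planes. -/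
noncomputable def polarBody (u : ℝ → ℝ) : Set Plane := {x | ∀ s, supportForm u s x ≤ 1}

/-- The curve with polar radius `1 / u`. -/
noncomputable def polarCurve (u : ℝ → ℝ) (s : ℝ) : Plane := (u s)⁻¹ • circlePoint s

theorem supportForm_add (u : ℝ → ℝ) (s : ℝ) (x y : Plane) :
    supportForm u s (x + y) = supportForm u s x + supportForm u s y := by
  simp only [supportForm, PiLp.add_apply]; ring

theorem supportForm_smul (u : ℝ → ℝ) (s c : ℝ) (x : Plane) :
    supportForm u s (c • x) = c * supportForm u s x := by
  simp only [supportForm, PiLp.smul_apply, smul_eq_mul]; ring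

theorem supportForm_neg (u : ℝ → ℝ) (s : ℝ) (x : Plane) :
    supportForm u s (-x) = -supportForm u s x := by
  simp only [supportForm, PiLp.neg_apply]; ring

theorem supportForm_circlePoint (u : ℝ → ℝ) (s t : ℝ) : supportForm u s (circlePoint t) =
    u s * Real.cos (t - s) + deriv u s * Real.sin (t - s) := by
  simp only [supportForm, circlePoint_apply_zero, circlePoint_apply_one, Real.cos_sub, Real.sin_sub]
  ring

theorem continuous_supportForm (u : ℝ → ℝ) (s : ℝ) : Continuous (supportForm u s) := by
  unfold supportForm
  fun_prop

namespace IsGaugeProfile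

variable {u : ℝ → ℝ}

theorem pos (hu : IsGaugeProfile u) (s : ℝ) : 0 < u s := zero_lt_one.trans_le (hu.one_le s)

theorem differentiable (hu : IsGaugeProfile u) : Differentiable ℝ u :=
  hu.contDiff.differentiable (by simp)

theorem contDiff_deriv (hu : IsGaugeProfile u) : ContDiff ℝ ∞ (deriv u) :=
  (contDiff_infty_iff_deriv.1 hu.contDiff).2

theorem differentiable_deriv (hu : IsGaugeProfile u) : Differentiable ℝ (deriv u) :=
  hu.contDiff_deriv.differentiable (by simp)

theorem deriv_periodic (hu : IsGaugeProfile u) (s : ℝ) : deriv u (s + Real.pi) = deriv u s := by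
  rw [← deriv_comp_add_const]
  congr 1
  exact funext hu.periodic

theorem eq_add_int_mul (hu : IsGaugeProfile u) (s : ℝ) (k : ℤ) : u (s + 2 * Real.pi * k) = u s := by
  have h : Function.Periodic u Real.pi := hu.periodic
  have := h.int_mul (2 * k) s
  rw [← this]
  congr 1; push_cast; ring

theorem supportForm_add_pi (hu : IsGaugeProfile u) (s : ℝ) (x : Plane) :
    supportForm u (s + Real.pi) x = -supportForm u s x := by
  simp only [supportForm, hu.periodic, hu.deriv_periodic, Real.cos_add_pi, Real.sin_add_pi]
  ring

theorem supportForm_self (u : ℝ → ℝ) (s : ℝ) : supportForm u s (circlePoint s) = u s := by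
  simp [supportForm_circlePoint]

/-- With `s` fixed and the contact angle `t` varying, the left side has derivative `(u + u'') (t) *
sin (s - t)`. It therefore increases strictly as `t` approaches `s` from either side, and it equals
`u s` at `t = s`. -/
theorem supportForm_lt_of_mem_Ioo (hu : IsGaugeProfile u) {p s : ℝ} (hne : s ≠ p) (h1 : p - Real.pi < s)
    (h2 : s < p + Real.pi) : u p * Real.cos (s - p) + deriv u p * Real.sin (s - p) < u s := by
  let G : ℝ → ℝ := fun t => u t * Real.cos (s - t) + deriv u t * Real.sin (s - t)
  have hG : ∀ t, HasDerivAt G ((u t + deriv (deriv u) t) * Real.sin (s - t)) t := by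
    intro t
    have hs : HasDerivAt (fun t : ℝ => s - t) (-1) t := by
      simpa using (hasDerivAt_id t).const_sub s
    have := ((hu.differentiable t).hasDerivAt.mul hs.cos).add
      ((hu.differentiable_deriv t).hasDerivAt.mul hs.sin)
    exact this.congr_deriv (by ring)
  have hGs : G s = u s := by simp [G]
  have hcont : Continuous G := continuous_iff_continuousAt.2 fun t => (hG t).continuousAt
  rw [← hGs]
  change G p < G s
  rcases lt_or_gt_of_ne hne with hlt | hlt
  · refine strictAntiOn_of_deriv_neg (convex_Icc s p) hcont.continuousOn (fun t ht => ?_)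
      (Set.left_mem_Icc.2 hlt.le) (Set.right_mem_Icc.2 hlt.le) hlt
    rw [interior_Icc] at ht
    rw [(hG t).deriv]
    exact mul_neg_of_pos_of_neg (hu.curvature_pos t)
      (Real.sin_neg_of_neg_of_neg_pi_lt (by linarith [ht.1]) (by linarith [ht.2]))
  · refine strictMonoOn_of_deriv_pos (convex_Icc p s) hcont.continuousOn (fun t ht => ?_)
      (Set.left_mem_Icc.2 hlt.le) (Set.right_mem_Icc.2 hlt.le) hlt
    rw [interior_Icc] at ht
    rw [(hG t).deriv]
    exact mul_pos (hu.curvature_pos t)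
      (Real.sin_pos_of_pos_of_lt_pi (by linarith [ht.2]) (by linarith [ht.1]))

theorem supportForm_lt (hu : IsGaugeProfile u) {p s : ℝ} (hne : circlePoint s ≠ circlePoint p) :
    supportForm u p (circlePoint s) < u s := by
  obtain ⟨k, hk, -⟩ := existsUnique_add_zsmul_mem_Ioc Real.two_pi_pos s (p - Real.pi)
  set s' := s + k • (2 * Real.pi) with hs'
  have hs'2 : s' = s + 2 * Real.pi * k := by rw [hs', zsmul_eq_mul]; ring
  have hc : circlePoint s' = circlePoint s := circlePoint_eq_iff.2 ⟨k, hs'2⟩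
  rw [← hu.eq_add_int_mul s k, ← hs'2, ← hc, supportForm_circlePoint]
  rw [← hc] at hne
  have hup : s' ≤ p + Real.pi := by linarith [hk.2]
  -- The antipodal angle `p + π` lies outside the monotonicity argument; there the form has the
  -- negative value `-u p`.
  rcases hup.lt_or_eq with hlt | heq
  · exact hu.supportForm_lt_of_mem_Ioo (fun h => hne (by rw [h])) hk.1 hlt
  · rw [heq]
    simp only [add_sub_cancel_left, Real.cos_pi, Real.sin_pi]
    linarith [hu.pos p, hu.pos (p + Real.pi)]

theorem supportForm_le (hu : IsGaugeProfile u) (p s : ℝ) :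
    supportForm u p (circlePoint s) ≤ u s := by
  by_cases h : circlePoint s = circlePoint p
  · obtain ⟨k, hk⟩ := circlePoint_eq_iff.1 h
    rw [h, supportForm_self, hk, hu.eq_add_int_mul]
  · exact (hu.supportForm_lt h).le

/-- Among all the half-planes, the one belonging to the angle of the point itself is the most
restrictive, so infinitely many constraints reduce to one. -/
theorem smul_mem_polarBody (hu : IsGaugeProfile u) {r : ℝ} (hr : 0 ≤ r) (s : ℝ) :
    r • circlePoint s ∈ polarBody u ↔ r * u s ≤ 1 := by
  constructor
  · intro h
    have := h s
    rwa [supportForm_smul, supportForm_self] at this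
  · intro h p
    rw [supportForm_smul]
    exact (mul_le_mul_of_nonneg_left (hu.supportForm_le p s) hr).trans h

theorem convex_polarBody (u : ℝ → ℝ) : Convex ℝ (polarBody u) := by
  intro x hx y hy a b ha hb hab s
  rw [supportForm_add, supportForm_smul, supportForm_smul]
  nlinarith [hx s, hy s]

theorem isClosed_polarBody (u : ℝ → ℝ) : IsClosed (polarBody u) := by
  have : polarBody u = ⋂ s, {x | supportForm u s x ≤ 1} := by
    ext x; simp [polarBody]
  rw [this]
  exact isClosed_iInter fun s => isClosed_le (continuous_supportForm u s) continuous_const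

theorem exists_le (hu : IsGaugeProfile u) : ∃ B, 0 < B ∧ ∀ s, u s ≤ B := by
  have hper : Function.Periodic u Real.pi := hu.periodic
  obtain ⟨B, hB⟩ := (isCompact_Icc (a := (0 : ℝ)) (b := Real.pi)).bddAbove_image
    hu.contDiff.continuous.continuousOn
  have h : ∀ s, u s ≤ B := by
    intro s
    obtain ⟨y, hy, hys⟩ := hper.exists_mem_Ico₀ Real.pi_pos s
    rw [hys]
    exact hB ⟨y, ⟨hy.1, hy.2.le⟩, rfl⟩
  exact ⟨B, (hu.pos 0).trans_le (h 0), h⟩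

theorem polarBody_mem_nhds (hu : IsGaugeProfile u) : polarBody u ∈ nhds (0 : Plane) := by
  obtain ⟨B, hB, h⟩ := hu.exists_le
  refine Metric.mem_nhds_iff.2 ⟨B⁻¹, inv_pos.2 hB, fun x hx => ?_⟩
  obtain ⟨r, s, hr, rfl⟩ := exists_eq_smul_circlePoint x
  rw [hu.smul_mem_polarBody hr]
  rw [mem_ball_zero_iff, norm_smul, norm_circlePoint, mul_one, Real.norm_of_nonneg hr] at hx
  calc r * u s ≤ B⁻¹ * B := by
        have := hu.pos s
        gcongr
        exact h s
    _ = 1 := inv_mul_cancel₀ hB.ne'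

theorem gauge_smul_circlePoint (hu : IsGaugeProfile u) {r : ℝ} (hr : 0 ≤ r) (s : ℝ) :
    gauge (polarBody u) (r • circlePoint s) = r * u s := by
  rw [gauge_smul_of_nonneg hr, smul_eq_mul]
  congr 1
  -- Both numbers are nonnegative and pass the same tests `c * _ ≤ 1`, which forces equality; a zero
  -- gauge is excluded by the test `c = 2`, since `u ≥ 1`.
  have key : ∀ c : ℝ, 0 ≤ c → (c * gauge (polarBody u) (circlePoint s) ≤ 1 ↔ c * u s ≤ 1) := by
    intro c hc
    rw [← hu.smul_mem_polarBody hc, ← smul_eq_mul, ← gauge_smul_of_nonneg hc,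
      gauge_le_one_iff_mem_closure (convex_polarBody u) hu.polarBody_mem_nhds,
      (isClosed_polarBody u).closure_eq]
  have hpos := hu.pos s
  have h1 : (u s)⁻¹ * gauge (polarBody u) (circlePoint s) ≤ 1 :=
    (key _ (inv_nonneg.2 hpos.le)).2 (inv_mul_cancel₀ hpos.ne').le
  rw [inv_mul_le_iff₀ hpos, mul_one] at h1
  refine le_antisymm h1 ?_
  rcases (gauge_nonneg (s := polarBody u) (circlePoint s)).lt_or_eq with h0 | h0
  · have h2 := (key _ (inv_nonneg.2 h0.le)).1 (inv_mul_cancel₀ h0.ne').le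
    rwa [inv_mul_le_iff₀ h0, mul_one] at h2
  · have h2 := (key 2 (by norm_num)).1 (by rw [← h0]; norm_num)
    linarith [hu.one_le s]

theorem mem_interior_iff (hu : IsGaugeProfile u) {r : ℝ} (hr : 0 ≤ r) (s : ℝ) :
    r • circlePoint s ∈ interior (polarBody u) ↔ r * u s < 1 := by
  rw [← hu.gauge_smul_circlePoint hr,
    gauge_lt_one_iff_mem_interior (convex_polarBody u) hu.polarBody_mem_nhds]

theorem mem_frontier_iff (hu : IsGaugeProfile u) {r : ℝ} (hr : 0 ≤ r) (s : ℝ) :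
    r • circlePoint s ∈ frontier (polarBody u) ↔ r * u s = 1 := by
  rw [← hu.gauge_smul_circlePoint hr,
    gauge_eq_one_iff_mem_frontier (convex_polarBody u) hu.polarBody_mem_nhds]

theorem frontier_polarBody (hu : IsGaugeProfile u) :
    frontier (polarBody u) = Set.range (polarCurve u) := by
  ext x
  constructor
  · intro hx
    obtain ⟨r, s, hr, rfl⟩ := exists_eq_smul_circlePoint x
    rw [hu.mem_frontier_iff hr] at hx
    exact ⟨s, by rw [polarCurve, eq_inv_of_mul_eq_one_left hx]⟩
  · rintro ⟨s, rfl⟩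
    exact (hu.mem_frontier_iff (inv_nonneg.2 (hu.pos s).le) s).2 (inv_mul_cancel₀ (hu.pos s).ne')

theorem supportForm_polarCurve_self (hu : IsGaugeProfile u) (s : ℝ) :
    supportForm u s (polarCurve u s) = 1 := by
  rw [polarCurve, supportForm_smul, supportForm_self, inv_mul_cancel₀ (hu.pos s).ne']

/-- Equality in the support inequality occurs only at the contact point; this is the source of
strict convexity. -/
theorem eq_polarCurve (hu : IsGaugeProfile u) {s : ℝ} {x : Plane} (hx : x ∈ polarBody u)
    (h : supportForm u s x = 1) : x = polarCurve u s := by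
  obtain ⟨r, t, hr, rfl⟩ := exists_eq_smul_circlePoint x
  rw [hu.smul_mem_polarBody hr] at hx
  rw [supportForm_smul] at h
  have hr0 : 0 < r := lt_of_le_of_ne hr (by rintro rfl; simp at h)
  by_cases hc : circlePoint t = circlePoint s
  · rw [hc, supportForm_self] at h
    rw [hc, polarCurve, eq_inv_of_mul_eq_one_left h]
  · have := mul_lt_mul_of_pos_left (hu.supportForm_lt hc) hr0
    linarith

theorem mem_interior_of_supportForm_lt (hu : IsGaugeProfile u) {x : Plane}
    (h : ∀ s, supportForm u s x < 1) : x ∈ interior (polarBody u) := by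
  obtain ⟨r, s, hr, rfl⟩ := exists_eq_smul_circlePoint x
  rw [hu.mem_interior_iff hr]
  have := h s
  rwa [supportForm_smul, supportForm_self] at this

/-- Each tangent line meets the body in one point, so at least one of two distinct points satisfies
each constraint strictly. No uniformity in `s` is needed, because interior membership is decided by
the constraint at the angle of the combination. -/
theorem strictConvex_polarBody (hu : IsGaugeProfile u) : StrictConvex ℝ (polarBody u) := by
  intro x hx y hy hxy a b ha hb hab
  refine hu.mem_interior_of_supportForm_lt fun s => ?_
  rw [supportForm_add, supportForm_smul, supportForm_smul]
  have h : supportForm u s x < 1 ∨ supportForm u s y < 1 := by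
    by_contra! h
    exact hxy ((hu.eq_polarCurve hx (le_antisymm (hx s) h.1)).trans
      (hu.eq_polarCurve hy (le_antisymm (hy s) h.2)).symm)
  rcases h with h | h
  · nlinarith [hy s]
  · nlinarith [hx s]

theorem supportForm_le_gauge (hu : IsGaugeProfile u) (s : ℝ) (x : Plane) :
    supportForm u s x ≤ gauge (polarBody u) x := by
  obtain ⟨r, t, hr, rfl⟩ := exists_eq_smul_circlePoint x
  rw [hu.gauge_smul_circlePoint hr, supportForm_smul]
  exact mul_le_mul_of_nonneg_left (hu.supportForm_le s t) hr

theorem neg_polarBody (hu : IsGaugeProfile u) : -polarBody u = polarBody u := by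
  have h : ∀ x, x ∈ polarBody u → -x ∈ polarBody u := fun x hx s => by
    rw [supportForm_neg, ← hu.supportForm_add_pi]
    exact hx _
  ext x
  exact ⟨fun hx => by simpa using h _ hx, fun hx => h x hx⟩

theorem isSymmetricBody_polarBody (hu : IsGaugeProfile u) : IsSymmetricBody (polarBody u) where
  convex := convex_polarBody u
  compact := by
    refine Metric.isCompact_of_isClosed_isBounded (isClosed_polarBody u)
      ((Metric.isBounded_closedBall (x := 0) (r := 1)).subset ?_)
    intro x hx
    obtain ⟨r, s, hr, rfl⟩ := exists_eq_smul_circlePoint x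
    rw [hu.smul_mem_polarBody hr] at hx
    rw [mem_closedBall_zero_iff, norm_smul, norm_circlePoint, mul_one, Real.norm_of_nonneg hr]
    nlinarith [hu.one_le s]
  interior_nonempty := ⟨0, mem_interior_iff_mem_nhds.2 hu.polarBody_mem_nhds⟩
  symmetric := hu.neg_polarBody

theorem contDiff_polarCurve (hu : IsGaugeProfile u) : ContDiff ℝ ∞ (polarCurve u) :=
  (hu.contDiff.inv fun s => (hu.pos s).ne').smul contDiff_circlePoint

theorem hasDerivAt_polarCurve_zero (hu : IsGaugeProfile u) (s : ℝ) :
    HasDerivAt (fun s => polarCurve u s 0)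
      (-(u s * Real.sin s + deriv u s * Real.cos s) / u s ^ 2) s := by
  have hne := (hu.pos s).ne'
  have := ((hu.differentiable s).hasDerivAt.inv hne).mul (Real.hasDerivAt_cos s)
  exact this.congr_deriv (by simp only [Pi.inv_apply]; field_simp; ring)

theorem hasDerivAt_polarCurve_one (hu : IsGaugeProfile u) (s : ℝ) :
    HasDerivAt (fun s => polarCurve u s 1)
      ((u s * Real.cos s - deriv u s * Real.sin s) / u s ^ 2) s := by
  have hne := (hu.pos s).ne'
  have := ((hu.differentiable s).hasDerivAt.inv hne).mul (Real.hasDerivAt_sin s)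
  exact this.congr_deriv (by simp only [Pi.inv_apply]; field_simp; ring)

theorem hasSmoothBoundary_polarBody (hu : IsGaugeProfile u) : HasSmoothBoundary (polarBody u) := by
  refine ⟨polarCurve u, hu.contDiff_polarCurve, fun s h => ?_, hu.frontier_polarBody.symm⟩
  have hd := ((hu.contDiff_polarCurve.differentiable (by simp)) s).hasDerivAt
  rw [h] at hd
  have h0 := ((EuclideanSpace.proj (𝕜 := ℝ) (0 : Fin 2)).hasFDerivAt.comp_hasDerivAt s hd).unique
    (hu.hasDerivAt_polarCurve_zero s)
  have h1 := ((EuclideanSpace.proj (𝕜 := ℝ) (1 : Fin 2)).hasFDerivAt.comp_hasDerivAt s hd).unique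
    (hu.hasDerivAt_polarCurve_one s)
  rw [map_zero] at h0 h1
  have hpos := hu.pos s
  have e0 : u s * Real.sin s + deriv u s * Real.cos s = 0 := by
    exact neg_eq_zero.1 ((div_eq_zero_iff.1 h0.symm).resolve_right (by positivity))
  have e1 : u s * Real.cos s - deriv u s * Real.sin s = 0 := by
    exact (div_eq_zero_iff.1 h1.symm).resolve_right (by positivity)
  refine hpos.ne' ?_
  linear_combination Real.sin s * e0 + Real.cos s * e1 - u s * Real.sin_sq_add_cos_sq s

/-- A support direction at a boundary point lies in the kernel of the support form. -/
theorem supportForm_eq_zero (hu : IsGaugeProfile u) {s : ℝ} {v : Plane}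
    (hv : ∀ t : ℝ, polarCurve u s + t • v ∉ interior (polarBody u)) : supportForm u s v = 0 := by
  by_contra hA
  -- Up to scale, `d` is the signed distance of a boundary point from the line through the point at
  -- `s` in direction `v`. If `v` is not tangent then `d' s ≠ 0`, so `d` takes both signs. A convex
  -- combination of two boundary points on opposite sides lies on the line, and by strict convexity
  -- in the interior.
  let d : ℝ → ℝ := fun φ => (polarCurve u φ 0 - polarCurve u s 0) * v 1
    - (polarCurve u φ 1 - polarCurve u s 1) * v 0
  have hpos := hu.pos s
  have hd : HasDerivAt d (-supportForm u s v / u s ^ 2) s := by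
    refine ((((hu.hasDerivAt_polarCurve_zero s).sub_const _).mul_const (v 1)).sub
      (((hu.hasDerivAt_polarCurve_one s).sub_const _).mul_const (v 0))).congr_deriv ?_
    simp only [supportForm]
    ring
  have hd0 : -supportForm u s v / u s ^ 2 ≠ 0 := div_ne_zero (neg_ne_zero.2 hA) (by positivity)
  have hds : d s = 0 := by simp [d]
  obtain ⟨p, hp⟩ : ∃ p, d p < 0 := by
    by_contra! h
    have hmin : IsLocalMin d s := Filter.Eventually.of_forall fun q => hds.trans_le (h q)
    exact hd0 (hmin.hasDerivAt_eq_zero hd)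
  obtain ⟨q, hq⟩ : ∃ q, 0 < d q := by
    by_contra! h
    have hmax : IsLocalMax d s := Filter.Eventually.of_forall fun q => (h q).trans_eq hds.symm
    exact hd0 (hmax.hasDerivAt_eq_zero hd)
  have hmem : ∀ r, polarCurve u r ∈ polarBody u := fun r =>
    (hu.smul_mem_polarBody (inv_nonneg.2 (hu.pos r).le) r).2 (inv_mul_cancel₀ (hu.pos r).ne').le
  have hpq : polarCurve u p ≠ polarCurve u q := by
    intro h
    have : d p = d q := by simp only [d, h]
    linarith
  have hw := hu.strictConvex_polarBody (hmem p) (hmem q) hpq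
    (a := d q / (d q - d p)) (b := -d p / (d q - d p))
    (div_pos hq (by linarith)) (div_pos (by linarith) (by linarith))
    (by rw [← add_div, ← sub_eq_add_neg]; exact div_self (by linarith))
  have hv0 : v ≠ 0 := by
    rintro rfl
    simp [supportForm] at hA
  obtain ⟨t, ht⟩ := exists_eq_smul_of_det_eq_zero
    (x := (d q / (d q - d p)) • polarCurve u p + (-d p / (d q - d p)) • polarCurve u q
      - polarCurve u s) hv0 (by
    have hne : d q - d p ≠ 0 := by linarith
    have h1 : d q / (d q - d p) + -d p / (d q - d p) = 1 := by
      rw [← add_div, ← sub_eq_add_neg]; exact div_self hne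
    have h2 : d q / (d q - d p) * d p + -d p / (d q - d p) * d q = 0 := by ring
    generalize d q / (d q - d p) = a at h1 h2
    generalize -d p / (d q - d p) = b at h1 h2
    obtain rfl : b = 1 - a := by linarith
    simp only [d] at h2
    simp only [PiLp.sub_apply, PiLp.add_apply, PiLp.smul_apply, smul_eq_mul]
    linear_combination h2)
  refine hv t ?_
  rw [← ht, add_sub_cancel]
  exact hw

theorem isSupportDirection_iff (hu : IsGaugeProfile u) {s : ℝ} {v : Plane} :
    IsSupportDirection (polarBody u) (polarCurve u s) v ↔ v ≠ 0 ∧ supportForm u s v = 0 := by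
  refine and_congr_right fun _ => ⟨hu.supportForm_eq_zero, fun h t ht => ?_⟩
  have h1 := interior_subset_gauge_lt_one _ ht
  have h2 := hu.supportForm_le_gauge s (polarCurve u s + t • v)
  rw [supportForm_add, supportForm_smul, h, hu.supportForm_polarCurve_self] at h2
  have h3 : gauge (polarBody u) (polarCurve u s + t • v) < 1 := h1
  linarith

/-- The interior is where the gauge is below `1`, so orthogonality at a boundary point says that the
line in direction `v` misses the interior, that is, supports the body. -/
theorem birkhoffOrth_iff (hu : IsGaugeProfile u) {s : ℝ} {v : Plane} :
    BirkhoffOrth (polarBody u) (polarCurve u s) v ↔ v ≠ 0 ∧ supportForm u s v = 0 := by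
  have hne : polarCurve u s ≠ 0 := smul_ne_zero (inv_ne_zero (hu.pos s).ne') (circlePoint_ne_zero s)
  have hg : gauge (polarBody u) (polarCurve u s) = 1 := by
    rw [polarCurve, hu.gauge_smul_circlePoint (inv_nonneg.2 (hu.pos s).le),
      inv_mul_cancel₀ (hu.pos s).ne']
  rw [← hu.isSupportDirection_iff]
  unfold BirkhoffOrth IsSupportDirection
  simp only [hne, hg, ne_eq, not_false_eq_true, true_and,
    ← gauge_lt_one_iff_mem_interior (convex_polarBody u) hu.polarBody_mem_nhds, not_lt]

theorem hasUniqueSupportLines_polarBody (hu : IsGaugeProfile u) :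
    HasUniqueSupportLines (polarBody u) := by
  intro x hx v w hv hw
  rw [hu.frontier_polarBody] at hx
  obtain ⟨s, rfl⟩ := hx
  rw [hu.isSupportDirection_iff] at hv hw
  refine exists_eq_smul_of_det_eq_zero hv.1 ?_
  obtain ⟨-, hv⟩ := hv
  obtain ⟨-, hw⟩ := hw
  -- This is the squared length of the coefficient vector of the support form; two vectors in the
  -- kernel of a nonzero form on the plane have zero determinant.
  have hpos : 0 < u s ^ 2 + deriv u s ^ 2 := by have := hu.pos s; positivity
  refine (mul_eq_zero.1 (?_ : (u s ^ 2 + deriv u s ^ 2) * _ = 0)).resolve_left hpos.ne'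
  unfold supportForm at hv hw
  have h1 := Real.sin_sq_add_cos_sq s
  linear_combination (-(w 0 * (u s * Real.sin s + deriv u s * Real.cos s))
    + w 1 * (u s * Real.cos s - deriv u s * Real.sin s)) * hv * (-1)
    + (-(v 0 * (u s * Real.sin s + deriv u s * Real.cos s))
    + v 1 * (u s * Real.cos s - deriv u s * Real.sin s)) * hw 
    - (u s ^ 2 + deriv u s ^ 2) * (w 0 * v 1 - w 1 * v 0) * h1

end IsGaugeProfile

/-! ### Birkhoff orthogonality and Auerbach points in polar coordinates -/

/-- The angle by which the tangent at angle `s` deviates from the normal to the radius. -/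
noncomputable def tilt (u : ℝ → ℝ) (s : ℝ) : ℝ := Real.arctan (deriv u s / u s)

/-- The polar angle of the tangent direction at the boundary point of angle `s`. -/
noncomputable def turn (u : ℝ → ℝ) (s : ℝ) : ℝ := s + Real.pi / 2 + tilt u s

theorem turn_of_tilt_eq_zero {u : ℝ → ℝ} {s : ℝ} (h : tilt u s = 0) :
    turn u s = s + Real.pi / 2 := by
  rw [turn, h, add_zero]

namespace IsGaugeProfile

variable {u : ℝ → ℝ}

theorem tilt_eq_zero_iff (hu : IsGaugeProfile u) {s : ℝ} : tilt u s = 0 ↔ deriv u s = 0 := by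
  rw [tilt, Real.arctan_eq_zero_iff, div_eq_zero_iff, or_iff_left (hu.pos s).ne']

theorem tilt_pos (hu : IsGaugeProfile u) {s : ℝ} (h : 0 < deriv u s) : 0 < tilt u s :=
  Real.arctan_pos.2 (div_pos h (hu.pos s))

theorem tilt_neg (hu : IsGaugeProfile u) {s : ℝ} (h : deriv u s < 0) : tilt u s < 0 :=
  Real.arctan_lt_zero.2 (div_neg_of_neg_of_pos h (hu.pos s))

theorem tilt_periodic (hu : IsGaugeProfile u) : Function.Periodic (tilt u) Real.pi := fun s => by
  rw [tilt, hu.periodic, hu.deriv_periodic, tilt]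

theorem turn_add_int_mul_pi (hu : IsGaugeProfile u) (s : ℝ) (k : ℤ) :
    turn u (s + k * Real.pi) = turn u s + k * Real.pi := by
  rw [turn, hu.tilt_periodic.int_mul, turn]; ring

/-- The derivative of `turn` is `u (u + u'') / (u² + u'²)`: tangents of a strictly convex curve
rotate in one direction. -/
theorem turn_strictMono (hu : IsGaugeProfile u) : StrictMono (turn u) := by
  refine strictMono_of_deriv_pos fun s => ?_
  have hpos := hu.pos s
  have h1 := ((hu.differentiable_deriv s).hasDerivAt.div (hu.differentiable s).hasDerivAt
    hpos.ne').arctan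
  have h2 : HasDerivAt (turn u) _ s := ((hasDerivAt_id s).add_const (Real.pi / 2)).add h1
  rw [h2.deriv]
  have h3 : (0 : ℝ) < u s ^ 2 + deriv u s ^ 2 := by positivity
  have : (1 : ℝ) + 1 / (1 + (deriv u / u) s ^ 2) *
      ((deriv (deriv u) s * u s - deriv u s * deriv u s) / u s ^ 2)
      = u s * (u s + deriv (deriv u) s) / (u s ^ 2 + deriv u s ^ 2) := by
    rw [Pi.div_apply]
    field_simp
    ring
  rw [this]
  exact div_pos (mul_pos hpos (hu.curvature_pos s)) h3

/-- Multiplied by `cos (tilt u s)`, the form becomes `u s * cos (t - s - tilt u s)`, so its zeros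
are the odd multiples of `π/2` shifted by `s + tilt u s`. -/
theorem supportForm_circlePoint_eq_zero_iff (hu : IsGaugeProfile u) {s t : ℝ} :
    supportForm u s (circlePoint t) = 0 ↔ ∃ k : ℤ, t = turn u s + k * Real.pi := by
  have hpos := hu.pos s
  have hcos : 0 < Real.cos (tilt u s) := Real.cos_arctan_pos _
  have hsin : u s * Real.sin (tilt u s) = deriv u s * Real.cos (tilt u s) := by
    have : Real.tan (tilt u s) = deriv u s / u s := Real.tan_arctan _
    rw [Real.tan_eq_sin_div_cos, div_eq_div_iff hcos.ne' hpos.ne'] at this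
    linarith
  have key : supportForm u s (circlePoint t) * Real.cos (tilt u s)
      = u s * Real.cos (t - s - tilt u s) := by
    rw [supportForm_circlePoint, Real.cos_sub (t - s)]
    linear_combination -Real.sin (t - s) * hsin
  have h1 : supportForm u s (circlePoint t) = 0 ↔ Real.cos (t - s - tilt u s) = 0 := by
    rw [← mul_eq_zero_iff_right hcos.ne', key, mul_eq_zero_iff_left hpos.ne']
  rw [h1, Real.cos_eq_zero_iff]
  refine exists_congr fun k => ?_
  unfold turn
  constructor <;> intro h <;> linarith

theorem birkhoffOrth_polarCurve_iff (hu : IsGaugeProfile u) {s t : ℝ} :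
    BirkhoffOrth (polarBody u) (polarCurve u s) (polarCurve u t) ↔
      ∃ k : ℤ, t = turn u s + k * Real.pi := by
  have hne : polarCurve u t ≠ 0 := smul_ne_zero (inv_ne_zero (hu.pos t).ne') (circlePoint_ne_zero t)
  rw [hu.birkhoffOrth_iff, and_iff_right hne, polarCurve, supportForm_smul,
    mul_eq_zero_iff_left (inv_ne_zero (hu.pos t).ne'), hu.supportForm_circlePoint_eq_zero_iff]

/-- Mutual orthogonality means that `turn` applied twice returns to `s` modulo `π`, and `turn (turn
s) = s + π + (tilt s + tilt (turn s))`. -/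
theorem polarCurve_mem_auerbachSet_iff (hu : IsGaugeProfile u) {s : ℝ} :
    polarCurve u s ∈ auerbachSet (polarBody u) ↔ tilt u s + tilt u (turn u s) = 0 := by
  have hmem : ∀ t, polarCurve u t ∈ frontier (polarBody u) := fun t => by
    rw [hu.frontier_polarBody]; exact ⟨t, rfl⟩
  have htt : turn u (turn u s) = s + Real.pi + (tilt u s + tilt u (turn u s)) := by
    rw [turn]; nth_rewrite 1 [turn]; ring
  constructor
  · rintro ⟨-, y, hy, h1, h2⟩
    rw [hu.frontier_polarBody] at hy
    obtain ⟨t, rfl⟩ := hy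
    obtain ⟨k, rfl⟩ := hu.birkhoffOrth_polarCurve_iff.1 h1
    obtain ⟨j, hj⟩ := hu.birkhoffOrth_polarCurve_iff.1 h2
    rw [hu.turn_add_int_mul_pi, htt] at hj
    have hp := Real.pi_pos
    have e : tilt u s + tilt u (turn u s) = ((-(1 + k + j) : ℤ) : ℝ) * Real.pi := by
      push_cast; linarith
    -- Each tilt lies strictly between `-π/2` and `π/2`, so a sum that is a multiple of `π` must
    -- vanish.
    have b1 := Real.neg_pi_div_two_lt_arctan (deriv u s / u s)
    have b2 := Real.arctan_lt_pi_div_two (deriv u s / u s)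
    have b3 := Real.neg_pi_div_two_lt_arctan (deriv u (turn u s) / u (turn u s))
    have b4 := Real.arctan_lt_pi_div_two (deriv u (turn u s) / u (turn u s))
    change -(Real.pi / 2) < tilt u s at b1
    change tilt u s < _ at b2
    change -(Real.pi / 2) < tilt u (turn u s) at b3
    change tilt u (turn u s) < _ at b4
    generalize -(1 + k + j) = m at e
    have hm1 : (-1 : ℝ) < m := by nlinarith
    have hm2 : (m : ℝ) < 1 := by nlinarith
    have hm : m = 0 := by
      have : -1 < m := by exact_mod_cast hm1
      have : m < 1 := by exact_mod_cast hm2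
      omega
    rw [e, hm]; simp
  · intro h
    refine ⟨hmem s, polarCurve u (turn u s), hmem _, hu.birkhoffOrth_polarCurve_iff.2 ⟨0, by simp⟩,
      hu.birkhoffOrth_polarCurve_iff.2 ⟨-1, ?_⟩⟩
    rw [htt, h]; push_cast; ring

/-- Since `turn` is increasing and `turn m = m + π/2`, the angle `s + tilt u s` has not passed `m`.
Thus `turn u s` stays in the quarter turn of the same half-gap, where the tilt is nonnegative. -/
theorem tilt_add_tilt_turn_pos (hu : IsGaugeProfile u) {α m s : ℝ}
    (hpos : ∀ t ∈ Set.Ioo α m, 0 < tilt u t) (hm : tilt u m = 0)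
    (hnn : ∀ t ∈ Set.Ioo α m, 0 ≤ tilt u (t + Real.pi / 2)) (hs : s ∈ Set.Ioo α m) :
    0 < tilt u s + tilt u (turn u s) := by
  have h1 := hpos s hs
  have h2 := hu.turn_strictMono hs.2
  rw [turn, turn_of_tilt_eq_zero hm] at h2
  have h3 := hnn (s + tilt u s) ⟨by linarith [hs.1], by linarith⟩
  have h4 : turn u s = s + tilt u s + Real.pi / 2 := by rw [turn]; ring
  rw [h4]
  linarith

theorem tilt_add_tilt_turn_neg (hu : IsGaugeProfile u) {m β s : ℝ}
    (hneg : ∀ t ∈ Set.Ioo m β, tilt u t < 0) (hm : tilt u m = 0)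
    (hnp : ∀ t ∈ Set.Ioo m β, tilt u (t + Real.pi / 2) ≤ 0) (hs : s ∈ Set.Ioo m β) :
    tilt u s + tilt u (turn u s) < 0 := by
  have h1 := hneg s hs
  have h2 := hu.turn_strictMono hs.1
  rw [turn_of_tilt_eq_zero hm, turn] at h2
  have h3 := hnp (s + tilt u s) ⟨by linarith, by linarith [hs.2]⟩
  have h4 : turn u s = s + tilt u s + Real.pi / 2 := by rw [turn]; ring
  rw [h4]
  linarith

theorem eq_add_of_polarCurve_eq (hu : IsGaugeProfile u) {s t : ℝ} (h : polarCurve u s = polarCurve u t) :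
    ∃ k : ℤ, s = t + 2 * Real.pi * k := by
  have hn := congrArg norm h
  have hs := inv_pos.2 (hu.pos s)
  have ht := inv_pos.2 (hu.pos t)
  rw [polarCurve, polarCurve, norm_smul, norm_smul, norm_circlePoint, norm_circlePoint, mul_one,
    mul_one, Real.norm_of_nonneg hs.le, Real.norm_of_nonneg ht.le] at hn
  rw [polarCurve, polarCurve, hn] at h
  exact circlePoint_eq_iff.1 (smul_right_injective Plane ht.ne' h)

theorem polarCurve_add_pi (hu : IsGaugeProfile u) (s : ℝ) :
    polarCurve u (s + Real.pi) = -polarCurve u s := by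
  rw [polarCurve, hu.periodic, circlePoint_add_pi, smul_neg, polarCurve]

theorem polarCurve_add_two_pi_mul (hu : IsGaugeProfile u) (s : ℝ) (k : ℤ) :
    polarCurve u (s + 2 * Real.pi * k) = polarCurve u s := by
  rw [polarCurve, hu.eq_add_int_mul, circlePoint_eq_iff.2 ⟨k, rfl⟩, polarCurve]

end IsGaugeProfile

/-! ### The Auerbach points of the perturbed circle -/

/-- The gauge profile of the curve with polar radius `1 - H`. -/
noncomputable def depthProfile (H : ℝ → ℝ) (s : ℝ) : ℝ := (1 - H s)⁻¹

theorem polarCurve_depthProfile (H : ℝ → ℝ) (s : ℝ) :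
    polarCurve (depthProfile H) s = (1 - H s) • circlePoint s := by
  rw [polarCurve, depthProfile, inv_inv]

theorem arcAngle_add_two_thirds (t : ℝ) : arcAngle (t + 2 / 3) = arcAngle t + Real.pi / 2 := by
  unfold arcAngle; ring

theorem arcAngle_sub_two_thirds (t : ℝ) :
    arcAngle (t - 2 / 3) = arcAngle t + Real.pi / 2 - Real.pi := by
  unfold arcAngle; ring

theorem arcAngle_one_third : arcAngle (1 / 3) = -(Real.pi / 8) := by unfold arcAngle; ring

theorem arcAngle_two_thirds : arcAngle (2 / 3) = Real.pi / 8 := by unfold arcAngle; ring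

theorem arcAngle_midpoint (u v : ℝ) : arcAngle ((u + v) / 2) = (arcAngle u + arcAngle v) / 2 := by
  unfold arcAngle; ring

theorem exists_arcAngle_eq (s : ℝ) : ∃ t, arcAngle t = s := by
  refine ⟨(s + 3 * Real.pi / 8) / (3 * Real.pi / 4), ?_⟩
  unfold arcAngle
  field_simp
  ring

theorem arcAngle_mem_of_mem_unitInterval {t : ℝ} (ht : t ∈ Set.Icc (0 : ℝ) 1) :
    -(3 * Real.pi / 8) ≤ arcAngle t ∧ arcAngle t ≤ 3 * Real.pi / 8 := by
  rw [← arcAngle_zero, ← arcAngle_one]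
  exact ⟨arcAngle_strictMono.monotone ht.1, arcAngle_strictMono.monotone ht.2⟩

/-! ### Signs of the tilt on the gaps and on the unperturbed arc -/

namespace IsDepth

variable {H : ℝ → ℝ}

theorem one_sub_pos (hH : IsDepth H) (s : ℝ) : 0 < 1 - H s := by linarith [hH.le s]

theorem hasDerivAt (hH : IsDepth H) (s : ℝ) : HasDerivAt H (deriv H s) s :=
  (hH.contDiff.differentiable (by simp) s).hasDerivAt

theorem deriv_depthProfile (hH : IsDepth H) :
    deriv (depthProfile H) = fun s => deriv H s / (1 - H s) ^ 2 := by
  funext s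
  have := (((hH.hasDerivAt s).const_sub 1).inv (hH.one_sub_pos s).ne').deriv
  rw [neg_neg] at this
  exact this

theorem isGaugeProfile (hH : IsDepth H) : IsGaugeProfile (depthProfile H) where
  contDiff := (contDiff_const.sub hH.contDiff).inv fun s => (hH.one_sub_pos s).ne'
  periodic s := by rw [depthProfile, hH.periodic, depthProfile]
  one_le s := (one_le_inv₀ (hH.one_sub_pos s)).2 (by linarith [hH.nonneg s])
  curvature_pos s := by
    have hpos := hH.one_sub_pos s
    have h2 : HasDerivAt (deriv H) (deriv (deriv H) s) s :=
      ((contDiff_infty_iff_deriv.1 hH.contDiff).2.differentiable (by simp) s).hasDerivAt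
    have h3 := (h2.div (((hH.hasDerivAt s).const_sub 1).pow 2)
      (show (1 - H s) ^ 2 ≠ 0 from pow_ne_zero 2 hpos.ne')).deriv
    have h4 : deriv (deriv (depthProfile H)) s =
        (deriv (deriv H) s * (1 - H s) + 2 * deriv H s ^ 2) / (1 - H s) ^ 3 := by
      rw [hH.deriv_depthProfile]
      refine h3.trans ?_
      simp only [Pi.pow_apply]
      field_simp
      push_cast
      ring
    have h5 : depthProfile H s + deriv (deriv (depthProfile H)) s =
        ((1 - H s) * ((1 - H s) + deriv (deriv H) s) + 2 * deriv H s ^ 2) / (1 - H s) ^ 3 := by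
      rw [h4, depthProfile]
      field_simp
      ring
    rw [h5]
    have h6 := (abs_le.1 (hH.deriv2_le s)).1
    -- The bounds give `1 - H ≥ 3/4` and `H'' ≥ -1/4`.
    have h7 : 0 < (1 - H s) + deriv (deriv H) s := by linarith [hH.le s]
    positivity

theorem tilt_eq_zero (hH : IsDepth H) {s : ℝ} (h : deriv H s = 0) :
    tilt (depthProfile H) s = 0 := by
  rw [hH.isGaugeProfile.tilt_eq_zero_iff, hH.deriv_depthProfile]
  simp [h]

/-- A zero of the nonnegative function `H` is a minimum. -/
theorem tilt_eq_zero_of_eq_zero (hH : IsDepth H) {s : ℝ} (h : H s = 0) :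
    tilt (depthProfile H) s = 0 := by
  refine hH.tilt_eq_zero ?_
  have : IsLocalMin H s := Filter.Eventually.of_forall fun t => h.trans_le (hH.nonneg t)
  exact this.deriv_eq_zero

theorem deriv_on_gap (hH : IsDepth H) {u v : ℝ} (huv : IsCantorGap u v) :
    ∃ c : ℝ, 0 < c ∧ ∀ s ∈ Set.Ioo (arcAngle u) (arcAngle v), deriv H s =
      c * deriv bump (2 / (arcAngle v - arcAngle u) * (s - (arcAngle u + arcAngle v) / 2)) := by
  obtain ⟨ε, hε, hh⟩ := hH.on_gap u v huv
  have hlen : 0 < arcAngle v - arcAngle u := sub_pos.2 (arcAngle_strictMono huv.1)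
  refine ⟨ε * (2 / (arcAngle v - arcAngle u)), by positivity, fun s hs => ?_⟩
  have h1 : H =ᶠ[nhds s] fun s =>
      ε * bump (2 / (arcAngle v - arcAngle u) * (s - (arcAngle u + arcAngle v) / 2)) := by
    filter_upwards [isOpen_Ioo.mem_nhds hs] with t ht
    exact hh t ⟨ht.1.le, ht.2.le⟩
  have h2 : HasDerivAt (fun s => 2 / (arcAngle v - arcAngle u) * (s - (arcAngle u + arcAngle v) / 2))
      (2 / (arcAngle v - arcAngle u)) s := by
    simpa using ((hasDerivAt_id s).sub_const ((arcAngle u + arcAngle v) / 2)).const_mul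
      (2 / (arcAngle v - arcAngle u))
  have h3 := ((contDiff_bump.differentiable (by simp)
    (2 / (arcAngle v - arcAngle u) * (s - (arcAngle u + arcAngle v) / 2))).hasDerivAt.comp s
    h2).const_mul ε
  rw [h1.deriv_eq]
  exact h3.deriv.trans (by ring)

theorem tilt_pos_of_gap (hH : IsDepth H) {u v s : ℝ} (huv : IsCantorGap u v)
    (hs : s ∈ Set.Ioo (arcAngle u) ((arcAngle u + arcAngle v) / 2)) :
    0 < tilt (depthProfile H) s := by
  have hlen : 0 < arcAngle v - arcAngle u := sub_pos.2 (arcAngle_strictMono huv.1)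
  obtain ⟨c, hc, h⟩ := hH.deriv_on_gap huv
  refine hH.isGaugeProfile.tilt_pos ?_
  rw [hH.deriv_depthProfile]
  refine div_pos ?_ (pow_pos (hH.one_sub_pos s) 2)
  rw [h s ⟨hs.1, by linarith [hs.2]⟩]
  refine mul_pos hc (deriv_bump_pos ?_ ?_)
  · rw [div_mul_eq_mul_div, lt_div_iff₀ hlen]; linarith [hs.1]
  · exact mul_neg_of_pos_of_neg (by positivity) (by linarith [hs.2])

theorem tilt_neg_of_gap (hH : IsDepth H) {u v s : ℝ} (huv : IsCantorGap u v)
    (hs : s ∈ Set.Ioo ((arcAngle u + arcAngle v) / 2) (arcAngle v)) :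
    tilt (depthProfile H) s < 0 := by
  have hlen : 0 < arcAngle v - arcAngle u := sub_pos.2 (arcAngle_strictMono huv.1)
  obtain ⟨c, hc, h⟩ := hH.deriv_on_gap huv
  refine hH.isGaugeProfile.tilt_neg ?_
  rw [hH.deriv_depthProfile]
  refine div_neg_of_neg_of_pos ?_ (pow_pos (hH.one_sub_pos s) 2)
  rw [h s ⟨by linarith [hs.1], hs.2⟩]
  refine mul_neg_of_pos_of_neg hc (deriv_bump_neg ?_ ?_)
  · exact mul_pos (by positivity) (by linarith [hs.1])
  · rw [div_mul_eq_mul_div, div_lt_iff₀ hlen]; linarith [hs.2]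

theorem tilt_gap_midpoint (hH : IsDepth H) {u v : ℝ} (huv : IsCantorGap u v) :
    tilt (depthProfile H) ((arcAngle u + arcAngle v) / 2) = 0 := by
  have hlen : 0 < arcAngle v - arcAngle u := sub_pos.2 (arcAngle_strictMono huv.1)
  obtain ⟨c, -, h⟩ := hH.deriv_on_gap huv
  refine hH.tilt_eq_zero ?_
  rw [h _ ⟨by linarith, by linarith⟩, sub_self, mul_zero, deriv_bump_zero, mul_zero]

theorem tilt_cantor (hH : IsDepth H) {t : ℝ} (ht : t ∈ cantorSet) :
    tilt (depthProfile H) (arcAngle t) = 0 :=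
  hH.tilt_eq_zero_of_eq_zero (hH.on_cantor t ht)

theorem tilt_cantor_add (hH : IsDepth H) {t : ℝ} (ht : t ∈ cantorSet) :
    tilt (depthProfile H) (arcAngle t + Real.pi / 2) = 0 := by
  rcases lt_or_ge t (2 / 3) with h | h
  · rw [← arcAngle_add_two_thirds]
    exact hH.tilt_cantor (add_two_thirds_mem_cantorSet ht h)
  · rw [← hH.isGaugeProfile.tilt_periodic.sub_eq, ← arcAngle_sub_two_thirds]
    exact hH.tilt_cantor (sub_two_thirds_mem_cantorSet ht (by linarith))

/-- On the quarter turn of a gap the tilt has weakly the same signs as on the gap. -/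
theorem tilt_gap_add (hH : IsDepth H) {u v : ℝ} (huv : IsCantorGap u v) :
    (∀ t ∈ Set.Ioo (arcAngle u) ((arcAngle u + arcAngle v) / 2),
      0 ≤ tilt (depthProfile H) (t + Real.pi / 2)) ∧
    tilt (depthProfile H) ((arcAngle u + arcAngle v) / 2 + Real.pi / 2) = 0 ∧
    ∀ t ∈ Set.Ioo ((arcAngle u + arcAngle v) / 2) (arcAngle v),
      tilt (depthProfile H) (t + Real.pi / 2) ≤ 0 := by
  have hlen : 0 < arcAngle v - arcAngle u := sub_pos.2 (arcAngle_strictMono huv.1)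
  have hp := Real.pi_pos
  rcases huv.translate with ⟨rfl, rfl⟩ | ⟨-, h⟩ | ⟨-, h⟩
  · have key : ∀ t ∈ Set.Ioo (arcAngle (1 / 3)) (arcAngle (2 / 3)),
        tilt (depthProfile H) (t + Real.pi / 2) = 0 := by
      intro t ht
      rw [arcAngle_one_third, arcAngle_two_thirds] at ht
      exact hH.tilt_eq_zero_of_eq_zero
        (hH.on_rest _ ⟨by linarith [ht.1], by linarith [ht.2]⟩)
    exact ⟨fun t ht => (key t ⟨ht.1, by linarith [ht.2]⟩).ge, key _ ⟨by linarith, by linarith⟩,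
      fun t ht => (key t ⟨by linarith [ht.1], ht.2⟩).le⟩
  · have h1 := hH.tilt_gap_midpoint h
    rw [arcAngle_add_two_thirds, arcAngle_add_two_thirds] at h1
    refine ⟨fun t ht => (hH.tilt_pos_of_gap h ?_).le, ?_, fun t ht => (hH.tilt_neg_of_gap h ?_).le⟩
    · rw [arcAngle_add_two_thirds, arcAngle_add_two_thirds]
      exact ⟨by linarith [ht.1], by linarith [ht.2]⟩
    · rw [← h1]; congr 1; ring
    · rw [arcAngle_add_two_thirds, arcAngle_add_two_thirds]
      exact ⟨by linarith [ht.1], by linarith [ht.2]⟩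
  · have h1 := hH.tilt_gap_midpoint h
    have hper := hH.isGaugeProfile.tilt_periodic
    rw [arcAngle_sub_two_thirds, arcAngle_sub_two_thirds] at h1
    refine ⟨fun t ht => ?_, ?_, fun t ht => ?_⟩
    · rw [← hper.sub_eq]
      refine (hH.tilt_pos_of_gap h ?_).le
      rw [arcAngle_sub_two_thirds, arcAngle_sub_two_thirds]
      exact ⟨by linarith [ht.1], by linarith [ht.2]⟩
    · rw [← hper.sub_eq, ← h1]; congr 1; ring
    · rw [← hper.sub_eq]
      refine (hH.tilt_neg_of_gap h ?_).le
      rw [arcAngle_sub_two_thirds, arcAngle_sub_two_thirds]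
      exact ⟨by linarith [ht.1], by linarith [ht.2]⟩

theorem cantor_mem_auerbachSet (hH : IsDepth H) {t : ℝ} (ht : t ∈ cantorSet) :
    polarCurve (depthProfile H) (arcAngle t) ∈ auerbachSet (polarBody (depthProfile H)) := by
  rw [hH.isGaugeProfile.polarCurve_mem_auerbachSet_iff, turn_of_tilt_eq_zero (hH.tilt_cantor ht),
    hH.tilt_cantor ht, hH.tilt_cantor_add ht, add_zero]

theorem gap_mem_auerbachSet_iff (hH : IsDepth H) {u v s : ℝ} (huv : IsCantorGap u v)
    (hs : s ∈ Set.Ioo (arcAngle u) (arcAngle v)) :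
    polarCurve (depthProfile H) s ∈ auerbachSet (polarBody (depthProfile H)) ↔
      s = (arcAngle u + arcAngle v) / 2 := by
  have hm := hH.tilt_gap_midpoint huv
  obtain ⟨h1, h2, h3⟩ := hH.tilt_gap_add huv
  rw [hH.isGaugeProfile.polarCurve_mem_auerbachSet_iff]
  constructor
  · intro h
    by_contra hne
    rcases lt_or_gt_of_ne hne with hlt | hlt
    · exact (hH.isGaugeProfile.tilt_add_tilt_turn_pos (fun t ht => hH.tilt_pos_of_gap huv ht) hm h1
        ⟨hs.1, hlt⟩).ne' h
    · exact (hH.isGaugeProfile.tilt_add_tilt_turn_neg (fun t ht => hH.tilt_neg_of_gap huv ht) hm h3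
        ⟨hlt, hs.2⟩).ne h
  · rintro rfl
    rw [turn_of_tilt_eq_zero hm, hm, h2, add_zero]

/-- Here the tilt vanishes and `turn` is exactly a quarter turn, which modulo `π` lands in the
middle gap; the tilt vanishes there only at the midpoint. -/
theorem rest_mem_auerbachSet_iff (hH : IsDepth H) {s : ℝ}
    (hs : s ∈ Set.Ioo (3 * Real.pi / 8) (5 * Real.pi / 8)) :
    polarCurve (depthProfile H) s ∈ auerbachSet (polarBody (depthProfile H)) ↔
      s = Real.pi / 2 := by
  have h0 := hH.tilt_eq_zero_of_eq_zero (hH.on_rest s ⟨hs.1.le, hs.2.le⟩)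
  have hp := Real.pi_pos
  rw [hH.isGaugeProfile.polarCurve_mem_auerbachSet_iff, turn_of_tilt_eq_zero h0, h0, zero_add,
    ← hH.isGaugeProfile.tilt_periodic.sub_eq]
  have hm := hH.tilt_gap_midpoint isCantorGap_middle
  have hpos := fun t => hH.tilt_pos_of_gap (s := t) isCantorGap_middle
  have hneg := fun t => hH.tilt_neg_of_gap (s := t) isCantorGap_middle
  rw [arcAngle_one_third, arcAngle_two_thirds] at hm hpos hneg
  constructor
  · intro h
    by_contra hne
    rcases lt_or_gt_of_ne hne with hlt | hlt
    · exact (hpos (s + Real.pi / 2 - Real.pi) ⟨by linarith [hs.1], by linarith⟩).ne' h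
    · exact (hneg (s + Real.pi / 2 - Real.pi) ⟨by linarith, by linarith [hs.2]⟩).ne h
  · rintro rfl
    rw [← hm]; congr 1; ring

end IsDepth

/-! ### Partition of the angles modulo `π`, and cones isolating a gap -/

/-- The angles of the isolated Auerbach points up to sign: the midpoints of the gaps and `π / 2`. -/
noncomputable def isolatedAngle : Option CantorGap → ℝ
  | none => Real.pi / 2
  | some i => (arcAngle i.1.1 + arcAngle i.1.2) / 2

/-- The open interval of angles around an isolated Auerbach point. -/
def angleGap : Option CantorGap → Set ℝ
  | none => Set.Ioo (3 * Real.pi / 8) (5 * Real.pi / 8)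
  | some i => Set.Ioo (arcAngle i.1.1) (arcAngle i.1.2)

theorem isolatedAngle_mem (o : Option CantorGap) : isolatedAngle o ∈ angleGap o := by
  have hp := Real.pi_pos
  rcases o with _ | i
  · exact ⟨by simp only [isolatedAngle]; linarith, by simp only [isolatedAngle]; linarith⟩
  · have := arcAngle_strictMono i.2.1
    exact ⟨by simp only [isolatedAngle]; linarith, by simp only [isolatedAngle]; linarith⟩

theorem angleGap_eq_Ioo (o : Option CantorGap) :
    ∃ p q, angleGap o = Set.Ioo p q ∧ q < p + Real.pi := by
  have hp := Real.pi_pos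
  rcases o with _ | i
  · exact ⟨_, _, rfl, by linarith⟩
  · refine ⟨_, _, rfl, ?_⟩
    have h1 := (arcAngle_mem_of_mem_unitInterval (cantorSet_subset_unitInterval i.2.2.1)).1
    have h2 := (arcAngle_mem_of_mem_unitInterval (cantorSet_subset_unitInterval i.2.2.2.1)).2
    linarith

/-- Modulo `π`, every angle is a Cantor angle or lies in a gap. -/
theorem exists_angle_cases (s : ℝ) : ∃ k : ℤ, (∃ t ∈ cantorSet, s = arcAngle t + k * Real.pi) ∨
    ∃ o, s - k * Real.pi ∈ angleGap o := by
  have hp := Real.pi_pos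
  -- The period `[-3π/8, 5π/8)` consists of the Cantor arc followed by the unperturbed arc.
  obtain ⟨k, hk, -⟩ := existsUnique_sub_zsmul_mem_Ico hp s (-(3 * Real.pi / 8))
  refine ⟨k, ?_⟩
  rw [zsmul_eq_mul] at hk
  rcases le_or_gt (s - k * Real.pi) (3 * Real.pi / 8) with h | h
  · obtain ⟨t, ht⟩ := exists_arcAngle_eq (s - k * Real.pi)
    have h0 : 0 ≤ t := by
      rw [← arcAngle_strictMono.le_iff_le, arcAngle_zero, ht]; exact hk.1
    have h1 : t ≤ 1 := by
      rw [← arcAngle_strictMono.le_iff_le, arcAngle_one, ht]; exact h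
    by_cases htC : t ∈ cantorSet
    · exact Or.inl ⟨t, htC, by rw [ht]; ring⟩
    · obtain ⟨u, v, huv, htuv⟩ := exists_isCantorGap h0 h1 htC
      refine Or.inr ⟨some ⟨(u, v), huv⟩, ?_⟩
      rw [← ht]
      exact ⟨arcAngle_strictMono htuv.1, arcAngle_strictMono htuv.2⟩
  · exact Or.inr ⟨none, h, by linarith [hk.2]⟩

/-- The open cone of the points with polar angle in `(p, q)`. -/
def openCone (p q : ℝ) : Set Plane :=
  {x | 0 < Real.cos p * x 1 - Real.sin p * x 0} ∩ {x | 0 < Real.sin q * x 0 - Real.cos q * x 1}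

theorem isOpen_openCone (p q : ℝ) : IsOpen (openCone p q) :=
  (isOpen_lt continuous_const (by fun_prop)).inter (isOpen_lt continuous_const (by fun_prop))

theorem smul_circlePoint_mem_openCone_iff {p q r s : ℝ} (hr : 0 < r) :
    r • circlePoint s ∈ openCone p q ↔ 0 < Real.sin (s - p) ∧ 0 < Real.sin (q - s) := by
  have h1 : Real.cos p * (r • circlePoint s) 1 - Real.sin p * (r • circlePoint s) 0
      = r * Real.sin (s - p) := by
    simp only [PiLp.smul_apply, smul_eq_mul, circlePoint_apply_zero, circlePoint_apply_one,
      Real.sin_sub]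
    ring
  have h2 : Real.sin q * (r • circlePoint s) 0 - Real.cos q * (r • circlePoint s) 1
      = r * Real.sin (q - s) := by
    simp only [PiLp.smul_apply, smul_eq_mul, circlePoint_apply_zero, circlePoint_apply_one,
      Real.sin_sub]
    ring
  simp only [openCone, Set.mem_inter_iff, Set.mem_ofPred_eq, h1, h2, mul_pos_iff_of_pos_left hr]

theorem smul_circlePoint_mem_openCone {p q r s : ℝ} (hr : 0 < r) (hpq : q < p + Real.pi)
    (hs : s ∈ Set.Ioo p q) : r • circlePoint s ∈ openCone p q :=
  (smul_circlePoint_mem_openCone_iff hr).2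
    ⟨Real.sin_pos_of_pos_of_lt_pi (by linarith [hs.1]) (by linarith [hs.2]),
      Real.sin_pos_of_pos_of_lt_pi (by linarith [hs.2]) (by linarith [hs.1])⟩

theorem exists_mem_Ioo_of_mem_openCone {p q r s : ℝ} (hr : 0 < r) (hlt : p < q)
    (hs : r • circlePoint s ∈ openCone p q) :
    ∃ k : ℤ, s + 2 * Real.pi * k ∈ Set.Ioo p q := by
  rw [smul_circlePoint_mem_openCone_iff hr] at hs
  obtain ⟨k, hk, -⟩ := existsUnique_add_zsmul_mem_Ioc Real.two_pi_pos s (p - Real.pi)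
  rw [zsmul_eq_mul, mul_comm] at hk
  refine ⟨k, ?_⟩
  have e1 : Real.sin (s + 2 * Real.pi * k - p) = Real.sin (s - p) := by
    rw [← Real.sin_add_int_mul_two_pi (s - p) k]; congr 1; ring
  have e2 : Real.sin (q - (s + 2 * Real.pi * k)) = Real.sin (q - s) := by
    rw [← Real.sin_sub_int_mul_two_pi (q - s) k]; congr 1; ring
  rw [← e1, ← e2] at hs
  obtain ⟨h1, h2⟩ := hs
  constructor
  · by_contra! h
    exact absurd h1 (not_lt.2 (Real.sin_nonpos_of_nonpos_of_neg_pi_le (by linarith)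
      (by linarith [hk.1])))
  · by_contra! h
    exact absurd h2 (not_lt.2 (Real.sin_nonpos_of_nonpos_of_neg_pi_le (by linarith)
      (by linarith [hk.2])))

namespace IsGaugeProfile

variable {u : ℝ → ℝ}

theorem polarCurve_add_int_mul_pi (hu : IsGaugeProfile u) (s : ℝ) (k : ℤ) :
    polarCurve u (s + k * Real.pi) = polarCurve u s ∨
      polarCurve u (s + k * Real.pi) = -polarCurve u s := by
  rcases Int.even_or_odd' k with ⟨j, rfl | rfl⟩
  · left
    rw [← hu.polarCurve_add_two_pi_mul s j]; congr 1; push_cast; ring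
  · right
    rw [← hu.polarCurve_add_pi, ← hu.polarCurve_add_two_pi_mul (s + Real.pi) j]
    congr 1; push_cast; ring

theorem polarCurve_add_int_mul_pi_mem_auerbachSet_iff (hu : IsGaugeProfile u) (s : ℝ) (k : ℤ) :
    polarCurve u (s + k * Real.pi) ∈ auerbachSet (polarBody u) ↔
      polarCurve u s ∈ auerbachSet (polarBody u) := by
  rw [hu.polarCurve_mem_auerbachSet_iff, hu.polarCurve_mem_auerbachSet_iff, hu.turn_add_int_mul_pi,
    hu.tilt_periodic.int_mul, hu.tilt_periodic.int_mul]

theorem exists_polarCurve_eq (hu : IsGaugeProfile u) {x : Plane}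
    (hx : x ∈ auerbachSet (polarBody u)) : ∃ s, polarCurve u s = x := by
  have := hx.1
  rwa [hu.frontier_polarBody] at this

theorem neg_auerbachSet (hu : IsGaugeProfile u) :
    -auerbachSet (polarBody u) = auerbachSet (polarBody u) := by
  have h : ∀ x ∈ auerbachSet (polarBody u), -x ∈ auerbachSet (polarBody u) := by
    intro x hx
    obtain ⟨s, rfl⟩ := hu.exists_polarCurve_eq hx
    have := (hu.polarCurve_add_int_mul_pi_mem_auerbachSet_iff s 1).2 hx
    rwa [Int.cast_one, one_mul, hu.polarCurve_add_pi] at this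
  ext x
  exact ⟨fun hx => by simpa using h _ hx, fun hx => h x hx⟩

end IsGaugeProfile

theorem lipschitzWith_circlePoint : LipschitzWith 2 circlePoint := by
  refine LipschitzWith.of_dist_le_mul fun s t => ?_
  rw [EuclideanSpace.dist_eq, Fin.sum_univ_two]
  have h0 : dist (Real.cos s) (Real.cos t) ≤ dist s t := Real.abs_cos_sub_cos_le s t
  have h1 : dist (Real.sin s) (Real.sin t) ≤ dist s t := Real.abs_sin_sub_sin_le s t
  refine Real.sqrt_le_iff.2 ⟨by positivity, ?_⟩
  simp only [circlePoint_apply_zero, circlePoint_apply_one, NNReal.coe_ofNat]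
  have h2 := pow_le_pow_left₀ dist_nonneg h0 2
  have h3 := pow_le_pow_left₀ dist_nonneg h1 2
  nlinarith [sq_nonneg (dist s t)]

theorem lipschitzWith_arcAngle : ∃ C, LipschitzWith C arcAngle := by
  refine ⟨(3 * Real.pi / 4).toNNReal, LipschitzWith.of_dist_le_mul fun s t => ?_⟩
  have hp := Real.pi_pos
  rw [Real.coe_toNNReal _ (by positivity), Real.dist_eq, Real.dist_eq]
  have : arcAngle s - arcAngle t = 3 * Real.pi / 4 * (s - t) := by unfold arcAngle; ring
  rw [this, abs_mul, abs_of_pos (by positivity : 0 < 3 * Real.pi / 4)]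

theorem hausdorffMeasure_cantorArc : Measure.hausdorffMeasure 1 cantorArc = 0 := by
  obtain ⟨C, hC⟩ := lipschitzWith_arcAngle
  have h := (lipschitzWith_circlePoint.comp hC).hausdorffMeasure_image_le zero_le_one cantorSet
  rw [hausdorffMeasure_real, volume_cantorSet, mul_zero] at h
  exact le_antisymm h bot_le

theorem disjoint_cantorArc : Disjoint cantorArc (-cantorArc) := by
  have hp := Real.pi_pos
  have h : ∀ x ∈ cantorArc, 0 < x 0 := by
    rintro x ⟨t, ht, rfl⟩
    have := arcAngle_mem_of_mem_unitInterval (cantorSet_subset_unitInterval ht)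
    exact Real.cos_pos_of_mem_Ioo ⟨by linarith, by linarith⟩
  refine Set.disjoint_left.2 fun x hx hx' => ?_
  have h1 := h x hx
  have h2 := h (-x) hx'
  rw [PiLp.neg_apply] at h2
  linarith

/-- One of each pair of opposite isolated Auerbach points. -/
noncomputable def isolatedPoints (H : ℝ → ℝ) : Set Plane :=
  Set.range fun o => polarCurve (depthProfile H) (isolatedAngle o)

namespace IsDepth

variable {H : ℝ → ℝ}

theorem mem_auerbachSet_iff_of_mem_angleGap (hH : IsDepth H) {o : Option CantorGap} {s : ℝ}
    (hs : s ∈ angleGap o) :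
    polarCurve (depthProfile H) s ∈ auerbachSet (polarBody (depthProfile H)) ↔
      s = isolatedAngle o := by
  rcases o with _ | i
  · exact hH.rest_mem_auerbachSet_iff hs
  · exact hH.gap_mem_auerbachSet_iff i.2 hs

theorem polarCurve_cantor (hH : IsDepth H) {t : ℝ} (ht : t ∈ cantorSet) :
    polarCurve (depthProfile H) (arcAngle t) = circlePoint (arcAngle t) := by
  rw [polarCurve_depthProfile, hH.on_cantor t ht, sub_zero, one_smul]

theorem auerbachSet_eq (hH : IsDepth H) : auerbachSet (polarBody (depthProfile H)) =
    cantorArc ∪ -cantorArc ∪ (isolatedPoints H ∪ -isolatedPoints H) := by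
  have hu := hH.isGaugeProfile
  have hneg := hu.neg_auerbachSet
  have h1 : cantorArc ⊆ auerbachSet (polarBody (depthProfile H)) := by
    rintro _ ⟨t, ht, rfl⟩
    simp only [← hH.polarCurve_cantor ht]
    exact hH.cantor_mem_auerbachSet ht
  have h2 : isolatedPoints H ⊆ auerbachSet (polarBody (depthProfile H)) := by
    rintro _ ⟨o, rfl⟩
    exact (hH.mem_auerbachSet_iff_of_mem_angleGap (isolatedAngle_mem o)).2 rfl
  refine Set.Subset.antisymm (fun x hx => ?_) (Set.union_subset (Set.union_subset h1 ?_)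
    (Set.union_subset h2 ?_))
  · obtain ⟨s, rfl⟩ := hu.exists_polarCurve_eq hx
    obtain ⟨k, ⟨t, ht, rfl⟩ | ⟨o, ho⟩⟩ := exists_angle_cases s
    · left
      rcases hu.polarCurve_add_int_mul_pi (arcAngle t) k with h | h <;>
        rw [h, hH.polarCurve_cantor ht]
      · exact Or.inl ⟨t, ht, rfl⟩
      · exact Or.inr (Set.neg_mem_neg.2 ⟨t, ht, rfl⟩)
    · right
      obtain ⟨s', rfl⟩ : ∃ s', s = s' + k * Real.pi := ⟨s - k * Real.pi, by ring⟩
      rw [add_sub_cancel_right] at ho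
      rw [hu.polarCurve_add_int_mul_pi_mem_auerbachSet_iff,
        hH.mem_auerbachSet_iff_of_mem_angleGap ho] at hx
      subst hx
      rcases hu.polarCurve_add_int_mul_pi (isolatedAngle o) k with h | h <;> rw [h]
      · exact Or.inl ⟨o, rfl⟩
      · exact Or.inr (Set.neg_mem_neg.2 ⟨o, rfl⟩)
  · rw [← hneg]; exact Set.neg_subset_neg.2 h1
  · rw [← hneg]; exact Set.neg_subset_neg.2 h2

theorem countable_isolatedPoints (H : ℝ → ℝ) : (isolatedPoints H ∪ -isolatedPoints H).Countable := by
  have h : (isolatedPoints H).Countable := Set.countable_range _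
  refine h.union ?_
  rw [← Set.image_neg_eq_neg]
  exact h.image _

theorem infinite_isolatedPoints (hH : IsDepth H) :
    (isolatedPoints H ∪ -isolatedPoints H).Infinite := by
  refine Set.Infinite.mono Set.subset_union_left ?_
  have hinj : Function.Injective fun i : CantorGap =>
      polarCurve (depthProfile H) (isolatedAngle (some i)) := by
    intro i j hij
    obtain ⟨k, hk⟩ := hH.isGaugeProfile.eq_add_of_polarCurve_eq hij
    have hp := Real.pi_pos
    have hmem : ∀ i : CantorGap, (i.1.1 + i.1.2) / 2 ∈ Set.Ioo i.1.1 i.1.2 := fun i =>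
      ⟨by linarith [i.2.1], by linarith [i.2.1]⟩
    have hb : ∀ i : CantorGap, -(3 * Real.pi / 8) ≤ isolatedAngle (some i) ∧
        isolatedAngle (some i) ≤ 3 * Real.pi / 8 := fun i => by
      simp only [isolatedAngle]
      rw [← arcAngle_midpoint]
      exact arcAngle_mem_of_mem_unitInterval
        ⟨i.2.nonneg.trans (hmem i).1.le, (hmem i).2.le.trans i.2.le_one⟩
    -- Gap midpoints lie within `3π/4` of each other, less than a full turn.
    have hk0 : k = 0 := by
      have h1 : (-1 : ℝ) < k := by nlinarith [hb i, hb j]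
      have h2 : (k : ℝ) < 1 := by nlinarith [hb i, hb j]
      have h1 : -1 < k := by exact_mod_cast h1
      have h2 : k < 1 := by exact_mod_cast h2
      omega
    rw [hk0, Int.cast_zero, mul_zero, add_zero] at hk
    simp only [isolatedAngle, ← arcAngle_midpoint] at hk
    have hm := arcAngle_strictMono.injective hk
    obtain ⟨e1, e2⟩ := i.2.eq_of_mem j.2 (hmem i) (hm ▸ hmem j)
    exact Subtype.ext (Prod.ext e1 e2)
  refine (Set.infinite_range_of_injective hinj).mono ?_
  rintro _ ⟨i, rfl⟩
  exact ⟨some i, rfl⟩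

/-- The open cone over the angular gap isolates the point: it sees each angle modulo `2π`, hence
excludes the opposite gap, and the gap has one Auerbach angle. -/
theorem exists_isOpen_inter_auerbachSet (hH : IsDepth H) {x : Plane}
    (hx : x ∈ isolatedPoints H ∪ -isolatedPoints H) :
    ∃ U : Set Plane, IsOpen U ∧ U ∩ auerbachSet (polarBody (depthProfile H)) = {x} := by
  have hu := hH.isGaugeProfile
  have key : ∀ x ∈ isolatedPoints H, ∃ U : Set Plane, IsOpen U ∧
      U ∩ auerbachSet (polarBody (depthProfile H)) = {x} := by
    rintro _ ⟨o, rfl⟩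
    obtain ⟨p, q, ho, hpq⟩ := angleGap_eq_Ioo o
    have hmem := isolatedAngle_mem o
    have hlt : p < q := by rw [ho] at hmem; exact hmem.1.trans hmem.2
    have hA := (hH.mem_auerbachSet_iff_of_mem_angleGap hmem).2 rfl
    refine ⟨openCone p q, isOpen_openCone p q, Set.Subset.antisymm ?_ ?_⟩
    · rintro y ⟨hy, hyA⟩
      obtain ⟨s, rfl⟩ := hu.exists_polarCurve_eq hyA
      obtain ⟨k, hk⟩ := exists_mem_Ioo_of_mem_openCone (inv_pos.2 (hu.pos s)) hlt hy
      rw [← ho] at hk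
      rw [← hu.polarCurve_add_two_pi_mul s k] at hyA ⊢
      rw [hH.mem_auerbachSet_iff_of_mem_angleGap hk] at hyA
      rw [hyA]
      exact rfl
    · rintro _ rfl
      rw [ho] at hmem
      exact ⟨smul_circlePoint_mem_openCone (inv_pos.2 (hu.pos _)) hpq hmem, hA⟩
  rcases hx with hx | hx
  · exact key x hx
  · obtain ⟨U, hU, h⟩ := key (-x) hx
    refine ⟨-U, hU.neg, ?_⟩
    rw [← hu.neg_auerbachSet, ← Set.inter_neg, h, Set.neg_singleton, neg_neg]

theorem hausdorffMeasure_auerbachSet (hH : IsDepth H) :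
    Measure.hausdorffMeasure 1 (auerbachSet (polarBody (depthProfile H))) = 0 := by
  have := Measure.nullSingletonClass_hausdorff Plane (d := 1) one_pos
  have hneg : Measure.hausdorffMeasure 1 (-cantorArc) = 0 := by
    rw [← Set.image_neg_eq_neg, ← hausdorffMeasure_cantorArc]
    exact (LinearIsometryEquiv.neg ℝ (E := Plane)).isometry.hausdorffMeasure_image
      (Or.inl zero_le_one) _
  rw [hH.auerbachSet_eq]
  exact measure_union_null (measure_union_null hausdorffMeasure_cantorArc hneg)
    ((countable_isolatedPoints H).measure_zero _)

theorem isCantorBumpRadius (hH : IsDepth H) : IsCantorBumpRadius fun s => 1 - H s where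
  pos := hH.one_sub_pos
  periodic s := by rw [hH.periodic]
  on_cantor t ht := by rw [hH.on_cantor t ht, sub_zero]
  on_gap u v huv := by
    obtain ⟨ε, hε, h⟩ := hH.on_gap u v huv
    exact ⟨ε, hε, fun φ hφ => by rw [h φ hφ]⟩
  on_rest φ hφ := by rw [hH.on_rest φ hφ, sub_zero]

end IsDepth

/-! ### Arcs of the boundary curve -/

/-- The complex number of `x` after the rotation by the angle `-φ`. -/
noncomputable def rotatedComplex (φ : ℝ) (x : Plane) : ℂ :=
  ((Real.cos φ * x 0 + Real.sin φ * x 1 : ℝ) : ℂ)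
    + ((Real.cos φ * x 1 - Real.sin φ * x 0 : ℝ) : ℂ) * Complex.I

theorem continuous_rotatedComplex (φ : ℝ) : Continuous (rotatedComplex φ) := by
  unfold rotatedComplex
  fun_prop

theorem rotatedComplex_smul_circlePoint (φ r s : ℝ) : rotatedComplex φ (r • circlePoint s) =
    r * (Complex.cos (s - φ : ℝ) + Complex.sin (s - φ : ℝ) * Complex.I) := by
  rw [rotatedComplex, ← Complex.ofReal_cos, ← Complex.ofReal_sin, Real.cos_sub, Real.sin_sub]
  simp only [PiLp.smul_apply, smul_eq_mul, circlePoint_apply_zero, circlePoint_apply_one]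
  push_cast
  ring

/-- The polar angle of `x` in `(φ - π, φ + π]`. -/
noncomputable def angleFrom (φ : ℝ) (x : Plane) : ℝ := φ + Complex.arg (rotatedComplex φ x)

theorem angleFrom_smul_circlePoint {φ r s : ℝ} (hr : 0 < r)
    (hs : s ∈ Set.Ioc (φ - Real.pi) (φ + Real.pi)) : angleFrom φ (r • circlePoint s) = s := by
  rw [angleFrom, rotatedComplex_smul_circlePoint,
    Complex.arg_mul_cos_add_sin_mul_I hr ⟨by linarith [hs.1], by linarith [hs.2]⟩]
  ring

theorem continuousAt_angleFrom {φ r s : ℝ} (hr : 0 < r)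
    (hs : s ∈ Set.Ioo (φ - Real.pi) (φ + Real.pi)) :
    ContinuousAt (angleFrom φ) (r • circlePoint s) := by
  have h := angleFrom_smul_circlePoint hr ⟨hs.1, hs.2.le⟩
  rw [angleFrom] at h
  have hslit : rotatedComplex φ (r • circlePoint s) ∈ Complex.slitPlane := by
    refine Complex.mem_slitPlane_iff_arg.2 ⟨fun h' => by linarith [hs.2], ?_⟩
    rw [rotatedComplex_smul_circlePoint, ← Complex.exp_mul_I]
    exact mul_ne_zero (Complex.ofReal_ne_zero.2 hr.ne') (Complex.exp_ne_zero _)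
  exact continuousAt_const.add
    ((Complex.continuousAt_arg hslit).comp (continuous_rotatedComplex φ).continuousAt)

/-- A simple arc on the boundary curve that avoids the opposite of its first end point is the image
of the interval between the angles of its end points. -/
theorem IsGaugeProfile.eq_image_uIcc {u : ℝ → ℝ} (hu : IsGaugeProfile u) {C : Set Plane} {φ ψ : ℝ}
    (hC : C ⊆ frontier (polarBody u)) (harc : IsClosedArc C (polarCurve u φ) (polarCurve u ψ))
    (hψ : ψ ∈ Set.Ioo (φ - Real.pi) (φ + Real.pi)) (hopp : -polarCurve u φ ∉ C) :
    C = polarCurve u '' Set.uIcc φ ψ := by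
  obtain ⟨c, hc, hinj, h0, h1, rfl⟩ := harc
  have hp := Real.pi_pos
  have key : ∀ z ∈ c '' Set.Icc 0 1, ∃ s ∈ Set.Ioo (φ - Real.pi) (φ + Real.pi),
      z = polarCurve u s := by
    intro z hz
    have hz' := hC hz
    rw [hu.frontier_polarBody] at hz'
    obtain ⟨s, rfl⟩ := hz'
    obtain ⟨k, hk, -⟩ := existsUnique_add_zsmul_mem_Ioc Real.two_pi_pos s (φ - Real.pi)
    rw [zsmul_eq_mul, mul_comm (k : ℝ)] at hk
    rw [← hu.polarCurve_add_two_pi_mul s k] at hz ⊢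
    refine ⟨_, ⟨hk.1, lt_of_le_of_ne (by linarith [hk.2]) fun h => hopp ?_⟩, rfl⟩
    rwa [h, hu.polarCurve_add_pi] at hz
  have hangle : ∀ s ∈ Set.Ioo (φ - Real.pi) (φ + Real.pi), angleFrom φ (polarCurve u s) = s :=
    fun s hs => angleFrom_smul_circlePoint (inv_pos.2 (hu.pos s)) ⟨hs.1, hs.2.le⟩
  have hleft : ∀ z ∈ c '' Set.Icc 0 1, polarCurve u (angleFrom φ z) = z := by
    intro z hz
    obtain ⟨s, hs, rfl⟩ := key z hz
    rw [hangle s hs]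
  -- Since the arc misses the point opposite to its start, the polar angle is continuous along it,
  -- with no jump at `φ ± π`. The lifted path is continuous and injective, hence monotone, and fills
  -- the interval between its end values.
  let f : ℝ → ℝ := fun t => angleFrom φ (c t)
  have hf0 : f 0 = φ := by
    simp only [f, h0]; exact hangle φ ⟨by linarith, by linarith⟩
  have hf1 : f 1 = ψ := by
    simp only [f, h1]; exact hangle ψ hψ
  have hfc : ContinuousOn f (Set.Icc 0 1) := by
    intro t ht
    obtain ⟨s, hs, hst⟩ := key (c t) ⟨t, ht, rfl⟩
    refine ContinuousAt.comp_continuousWithinAt (g := angleFrom φ) ?_ (hc t ht)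
    rw [hst]
    exact continuousAt_angleFrom (inv_pos.2 (hu.pos s)) hs
  have hfi : Set.InjOn f (Set.Icc 0 1) := by
    intro t ht t' ht' h
    refine hinj ht ht' ?_
    rw [← hleft (c t) ⟨t, ht, rfl⟩, ← hleft (c t') ⟨t', ht', rfl⟩]
    exact congrArg _ h
  have hl : (0 : ℝ) ∈ Set.Icc (0 : ℝ) 1 := Set.left_mem_Icc.2 zero_le_one
  have hr : (1 : ℝ) ∈ Set.Icc (0 : ℝ) 1 := Set.right_mem_Icc.2 zero_le_one
  have himg : f '' Set.Icc 0 1 = Set.uIcc φ ψ := by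
    refine Set.Subset.antisymm ?_ ?_
    · rintro _ ⟨t, ht, rfl⟩
      rw [← hf0, ← hf1]
      rcases hfc.strictMonoOn_of_injOn_Icc' zero_le_one hfi with h | h
      · exact Set.mem_uIcc.2 (Or.inl ⟨h.monotoneOn hl ht ht.1, h.monotoneOn ht hr ht.2⟩)
      · exact Set.mem_uIcc.2 (Or.inr ⟨h.antitoneOn ht hr ht.2, h.antitoneOn hl ht ht.1⟩)
    · have := intermediate_value_uIcc (a := (0 : ℝ)) (b := 1) (f := f)
        (by rwa [Set.uIcc_of_le zero_le_one])
      rwa [hf0, hf1, Set.uIcc_of_le zero_le_one] at this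
  rw [← himg, Set.image_image]
  exact Set.image_congr fun t ht => (hleft (c t) ⟨t, ht, rfl⟩).symm

/-! ### The B-measure -/

/-- The point of the `j`-th quarter copy of the Cantor set in the circle. -/
noncomputable def quarterPoint (j : ℕ) (t : ℝ) : Plane :=
  circlePoint (arcAngle (t / 3) + j * (Real.pi / 2))

/-- The sum of the four quarter copies of a measure `ν`, with factor `π / 2`. -/
noncomputable def quarterMeasure (ν : Measure ℝ) : Measure Plane :=
  ENNReal.ofReal (Real.pi / 2) • ∑ j ∈ Finset.range 4, ν.map (quarterPoint j)

theorem continuous_quarterPoint (j : ℕ) : Continuous (quarterPoint j) := by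
  have h : Continuous arcAngle := by unfold arcAngle; fun_prop
  exact contDiff_circlePoint.continuous.comp
    ((h.comp (continuous_id.div_const 3)).add continuous_const)

theorem quarterPoint_add_two (j : ℕ) (t : ℝ) : quarterPoint (j + 2) t = -quarterPoint j t := by
  rw [quarterPoint, quarterPoint, ← circlePoint_add_pi]
  congr 1; push_cast; ring

theorem quarterMeasure_apply (ν : Measure ℝ) {X : Set Plane} (hX : MeasurableSet X) :
    quarterMeasure ν X = ENNReal.ofReal (Real.pi / 2) *
      ∑ j ∈ Finset.range 4, ν (quarterPoint j ⁻¹' X) := by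
  rw [quarterMeasure, Measure.smul_apply, smul_eq_mul, Measure.finsetSum_apply]
  congr 1
  exact Finset.sum_congr rfl fun j _ => Measure.map_apply (continuous_quarterPoint j).measurable hX

/-- Negation shifts the index of the quarter copies by two, and the index has period four, so the
copies are permuted. -/
theorem quarterMeasure_neg (ν : Measure ℝ) {X : Set Plane} (hX : MeasurableSet X) :
    quarterMeasure ν (-X) = quarterMeasure ν X := by
  have h : ∀ j, quarterPoint j ⁻¹' (-X) = quarterPoint (j + 2) ⁻¹' X := fun j => by
    ext t; simp [quarterPoint_add_two]
  have h4 : ∀ j, quarterPoint (j + 4) = quarterPoint j := fun j => by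
    funext t
    rw [show j + 4 = j + 2 + 2 by ring, quarterPoint_add_two, quarterPoint_add_two, neg_neg]
  rw [quarterMeasure_apply ν hX, quarterMeasure_apply ν hX.neg]
  congr 1
  simp only [h, Finset.sum_range_succ, Finset.sum_range_zero, zero_add]
  rw [show (2 + 2 : ℕ) = 0 + 4 by norm_num, show (3 + 2 : ℕ) = 1 + 4 by norm_num, h4, h4,
    show (1 + 2 : ℕ) = 3 by norm_num]
  ring

namespace IsDepth

variable {H : ℝ → ℝ}

/-- The parameter `t / 3` lies in the left third. Even multiples of `π/2` are periods of `H`, and an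
odd multiple amounts to moving to the right third. -/
theorem eq_zero_quarter (hH : IsDepth H) {t : ℝ} (ht : t ∈ cantorSet) (k : ℤ) :
    H (arcAngle (t / 3) + k * (Real.pi / 2)) = 0 := by
  have hper : Function.Periodic H Real.pi := hH.periodic
  have ht3 := div_three_mem_cantorSet ht
  have h1 := (cantorSet_subset_unitInterval ht).2
  rcases Int.even_or_odd' k with ⟨j, rfl | rfl⟩
  · rw [show arcAngle (t / 3) + ((2 * j : ℤ) : ℝ) * (Real.pi / 2) = arcAngle (t / 3) + j * Real.pi by
      push_cast; ring, hper.int_mul]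
    exact hH.on_cantor _ ht3
  · rw [show arcAngle (t / 3) + ((2 * j + 1 : ℤ) : ℝ) * (Real.pi / 2)
      = arcAngle (t / 3) + Real.pi / 2 + j * Real.pi by push_cast; ring, hper.int_mul,
      ← arcAngle_add_two_thirds]
    exact hH.on_cantor _ (add_two_thirds_mem_cantorSet ht3 (by linarith))

theorem turn_quarter (hH : IsDepth H) {t : ℝ} (ht : t ∈ cantorSet) (k : ℤ) :
    turn (depthProfile H) (arcAngle (t / 3) + k * (Real.pi / 2)) =
      arcAngle (t / 3) + (k + 1) * (Real.pi / 2) := by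
  rw [turn_of_tilt_eq_zero (hH.tilt_eq_zero_of_eq_zero (hH.eq_zero_quarter ht k))]
  ring

theorem quarterPoint_eq (hH : IsDepth H) {t : ℝ} (ht : t ∈ cantorSet) (j : ℕ) :
    quarterPoint j t = polarCurve (depthProfile H) (arcAngle (t / 3) + j * (Real.pi / 2)) := by
  have h := hH.eq_zero_quarter ht j
  rw [Int.cast_natCast] at h
  rw [polarCurve_depthProfile, h, sub_zero, one_smul, quarterPoint]

theorem isAngularMeasure_quarterMeasure (hH : IsDepth H) (ν : Measure ℝ) [IsProbabilityMeasure ν]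
    [NullSingletonClass ν] (hν : ν cantorSetᶜ = 0) :
    IsAngularMeasure (polarBody (depthProfile H)) (quarterMeasure ν) where
  outside := by
    rw [quarterMeasure_apply ν isClosed_frontier.measurableSet.compl]
    rw [Finset.sum_eq_zero, mul_zero]
    intro j _
    refine measure_mono_null (t := cantorSetᶜ) (fun t ht (htC : t ∈ cantorSet) => ht ?_) hν
    rw [hH.quarterPoint_eq htC, hH.isGaugeProfile.frontier_polarBody]
    exact ⟨_, rfl⟩
  total := by
    have h : ∀ j, ν (quarterPoint j ⁻¹' frontier (polarBody (depthProfile H))) = 1 := by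
      intro j
      refine le_antisymm prob_le_one ?_
      rw [← (prob_compl_eq_zero_iff isClosed_cantorSet.measurableSet).1 hν]
      refine measure_mono fun t ht => ?_
      rw [Set.mem_preimage, hH.quarterPoint_eq ht, hH.isGaugeProfile.frontier_polarBody]
      exact ⟨_, rfl⟩
    rw [quarterMeasure_apply ν isClosed_frontier.measurableSet]
    simp only [h, Finset.sum_const, Finset.card_range, nsmul_eq_mul, mul_one]
    rw [show (2 * Real.pi) = Real.pi / 2 * 4 by ring,
      ENNReal.ofReal_mul (by have := Real.pi_pos; positivity)]
    norm_num
  symmetric X _ hX := (quarterMeasure_neg ν hX).symm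
  continuous x _ := by
    rw [quarterMeasure_apply ν (measurableSet_singleton x), Finset.sum_eq_zero, mul_zero]
    intro j _
    -- On the Cantor set `quarterPoint j` is injective, so up to a null set the preimage of a point
    -- has at most one element.
    refine measure_mono_null (t := cantorSetᶜ ∪ (quarterPoint j ⁻¹' {x} ∩ cantorSet))
      (fun t ht => ?_) (measure_union_null hν (Set.Subsingleton.measure_zero ?_ ν))
    · by_cases htC : t ∈ cantorSet
      · exact Or.inr ⟨ht, htC⟩
      · exact Or.inl htC
    · rintro s ⟨hs, hsC⟩ t ⟨ht, htC⟩
      have h : quarterPoint j s = quarterPoint j t := hs.trans ht.symm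
      obtain ⟨k, hk⟩ := circlePoint_eq_iff.1 h
      have h1 := arcAngle_mem_of_mem_unitInterval
        (cantorSet_subset_unitInterval (div_three_mem_cantorSet hsC))
      have h2 := arcAngle_mem_of_mem_unitInterval
        (cantorSet_subset_unitInterval (div_three_mem_cantorSet htC))
      have hp := Real.pi_pos
      have hk0 : k = 0 := by
        have e1 : (-1 : ℝ) < k := by nlinarith
        have e2 : (k : ℝ) < 1 := by nlinarith
        have e1 : -1 < k := by exact_mod_cast e1
        have e2 : k < 1 := by exact_mod_cast e2
        omega
      rw [hk0, Int.cast_zero, mul_zero, add_zero] at hk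
      have := arcAngle_strictMono.injective (add_right_cancel hk)
      linarith

/-- The hypothesis says that a point of the orbit `θ + k π/2` is past `p` exactly when its successor
is past `q`. Hence only the first orbit point past `p` lies in `[p, q)`, and for almost every `t`
exactly one of the four quarter points lies on the arc. -/
theorem quarterMeasure_image_Icc (hH : IsDepth H) (ν : Measure ℝ) [IsProbabilityMeasure ν]
    [NullSingletonClass ν] (hν : ν cantorSetᶜ = 0) {p q : ℝ}
    (hpq : ∀ t ∈ cantorSet, ∀ k : ℤ, p ≤ arcAngle (t / 3) + k * (Real.pi / 2) ↔
      q ≤ arcAngle (t / 3) + (k + 1) * (Real.pi / 2)) :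
    quarterMeasure ν (polarCurve (depthProfile H) '' Set.Icc p q) =
      ENNReal.ofReal (Real.pi / 2) := by
  have hu := hH.isGaugeProfile
  have hp2 : 0 < Real.pi / 2 := by have := Real.pi_pos; positivity
  set C := polarCurve (depthProfile H) '' Set.Icc p q with hC
  have hCm : MeasurableSet C :=
    (isCompact_Icc.image hu.contDiff_polarCurve.continuous).isClosed.measurableSet
  have hA : ∀ j, MeasurableSet (quarterPoint j ⁻¹' C) := fun j =>
    (continuous_quarterPoint j).measurable hCm
  rw [quarterMeasure_apply ν hCm]
  suffices h : ∑ j ∈ Finset.range 4, ν (quarterPoint j ⁻¹' C) = 1 by rw [h, mul_one]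
  -- The count is exact for `[p, q)`; parameters whose orbit hits the end `q` of the closed interval
  -- are countably many, hence null.
  have hE : Set.Countable {t : ℝ | ∃ k : ℤ, arcAngle (t / 3) + k * (Real.pi / 2) = q} := by
    refine (Set.countable_iUnion fun k : ℤ => Set.Subsingleton.countable
      (s := {t : ℝ | arcAngle (t / 3) + k * (Real.pi / 2) = q}) ?_).mono
      fun t ⟨k, hk⟩ => Set.mem_iUnion.2 ⟨k, hk⟩
    intro s hs t ht
    have hs' : arcAngle (s / 3) + k * (Real.pi / 2) = q := hs
    have ht' : arcAngle (t / 3) + k * (Real.pi / 2) = q := ht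
    have := arcAngle_strictMono.injective (add_right_cancel (hs'.trans ht'.symm))
    linarith
  have hae : ∀ᵐ t ∂ν, ∑ j ∈ Finset.range 4, (quarterPoint j ⁻¹' C).indicator (1 : ℝ → ℝ≥0∞) t = 1 := by
    have h1 : ∀ᵐ t ∂ν, t ∈ cantorSet := hν
    have h2 : ∀ᵐ t ∂ν, t ∉ {t : ℝ | ∃ k : ℤ, arcAngle (t / 3) + k * (Real.pi / 2) = q} :=
      measure_eq_zero_iff_ae_notMem.1 (hE.measure_zero ν)
    filter_upwards [h1, h2] with t ht htE
    set θ := arcAngle (t / 3) with hθ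
    have hcond := hpq t ht
    rw [← hθ] at hcond
    -- This is the index of the first orbit point not before `p`; its residue modulo `4` selects the
    -- quarter copy.
    obtain ⟨k, hk⟩ : ∃ k : ℤ, k = ⌈(p - θ) / (Real.pi / 2)⌉ := ⟨_, rfl⟩
    have hk1 : p ≤ θ + k * (Real.pi / 2) := by
      have := Int.le_ceil ((p - θ) / (Real.pi / 2))
      rw [← hk, div_le_iff₀ hp2] at this
      linarith
    have hk2 : θ + ((k - 1 : ℤ) : ℝ) * (Real.pi / 2) < p := by
      have := Int.ceil_lt_add_one ((p - θ) / (Real.pi / 2))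
      rw [← hk, ← sub_lt_iff_lt_add, lt_div_iff₀ hp2] at this
      push_cast
      linarith
    have hk3 : θ + k * (Real.pi / 2) < q := by
      by_contra! h
      refine absurd ((hcond (k - 1)).2 ?_) (not_le.2 hk2)
      push_cast
      rwa [sub_add_cancel]
    have hj0 : ((k % 4).toNat : ℤ) = k % 4 := Int.toNat_of_nonneg (Int.emod_nonneg k (by norm_num))
    have hmem : ∀ (j : ℕ) (m : ℤ), (j : ℤ) + 4 * m = k → quarterPoint j t ∈ C := by
      intro j m hjm
      rw [hH.quarterPoint_eq ht, ← hθ, ← hu.polarCurve_add_two_pi_mul _ m]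
      refine ⟨_, ⟨hk1, hk3.le⟩, ?_⟩
      rw [← hjm]
      congr 1; push_cast; ring
    have huniq : ∀ j : ℕ, quarterPoint j t ∈ C → ∃ m : ℤ, (j : ℤ) + 4 * m = k := by
      rintro j ⟨s, hs, hst⟩
      rw [hH.quarterPoint_eq ht, ← hθ] at hst
      obtain ⟨m, hm⟩ := hu.eq_add_of_polarCurve_eq hst
      refine ⟨m, ?_⟩
      have hsm : s = θ + ((j + 4 * m : ℤ) : ℝ) * (Real.pi / 2) := by rw [hm]; push_cast; ring
      generalize (j : ℤ) + 4 * m = k' at hsm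
      have hsq : s < q := lt_of_le_of_ne hs.2 fun h => htE ⟨k', by rw [← h, hsm]⟩
      -- If the predecessor were also past `p`, then `s` would be past `q`. So `k'` is a first index
      -- past `p` as well and equals `k`.
      have hs1 : θ + ((k' - 1 : ℤ) : ℝ) * (Real.pi / 2) < p := by
        by_contra! h
        have h' := (hcond (k' - 1)).1 h
        push_cast at h'
        rw [sub_add_cancel, ← hsm] at h'
        linarith
      have hs2 := hs.1
      rw [hsm] at hs2
      push_cast at hs1 hk2
      have e1 : (k' : ℝ) - 1 < k := by nlinarith
      have e2 : (k : ℝ) - 1 < k' := by nlinarith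
      have e1 : k' - 1 < k := by exact_mod_cast e1
      have e2 : k - 1 < k' := by exact_mod_cast e2
      omega
    rw [Finset.sum_eq_single (k % 4).toNat]
    · exact Set.indicator_of_mem (s := quarterPoint (k % 4).toNat ⁻¹' C)
        (hmem _ (k / 4) (by omega)) _
    · intro j hj hne
      refine Set.indicator_of_notMem (fun h => hne ?_) _
      obtain ⟨m, hm⟩ := huniq j h
      have := Finset.mem_range.1 hj
      omega
    · intro h
      exact absurd (Finset.mem_range.2 (by omega)) h
  calc ∑ j ∈ Finset.range 4, ν (quarterPoint j ⁻¹' C)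
      = ∑ j ∈ Finset.range 4, ∫⁻ t, (quarterPoint j ⁻¹' C).indicator (1 : ℝ → ℝ≥0∞) t ∂ν :=
        Finset.sum_congr rfl fun j _ => (lintegral_indicator_one (hA j)).symm
    _ = ∫⁻ t, ∑ j ∈ Finset.range 4, (quarterPoint j ⁻¹' C).indicator (1 : ℝ → ℝ≥0∞) t ∂ν :=
        (lintegral_finsetSum _ fun j _ => measurable_one.indicator (hA j)).symm
    _ = ∫⁻ _, 1 ∂ν := lintegral_congr_ae hae
    _ = 1 := by simp

theorem isBMeasure_quarterMeasure (hH : IsDepth H) (ν : Measure ℝ) [IsProbabilityMeasure ν]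
    [NullSingletonClass ν] (hν : ν cantorSetᶜ = 0) :
    IsBMeasure (polarBody (depthProfile H)) (quarterMeasure ν) where
  angular := hH.isAngularMeasure_quarterMeasure ν hν
  arc := by
    intro C x y hC harc hopp hxy
    have hu := hH.isGaugeProfile
    have hmono := hu.turn_strictMono
    have hxC : x ∈ C := by
      obtain ⟨c, -, -, h0, -, rfl⟩ := harc
      exact ⟨0, by simp, h0⟩
    have hyC : y ∈ C := by
      obtain ⟨c, -, -, -, h1, rfl⟩ := harc
      exact ⟨1, by simp, h1⟩
    have hx := hC hxC
    have hy := hC hyC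
    rw [hu.frontier_polarBody] at hx hy
    obtain ⟨φ, rfl⟩ := hx
    obtain ⟨ψ, rfl⟩ := hy
    obtain ⟨k, rfl⟩ := hu.birkhoffOrth_polarCurve_iff.1 hxy
    have hp := Real.pi_pos
    have b1 := Real.neg_pi_div_two_lt_arctan (deriv (depthProfile H) φ / depthProfile H φ)
    have b2 := Real.arctan_lt_pi_div_two (deriv (depthProfile H) φ / depthProfile H φ)
    have hlow : φ < turn (depthProfile H) φ := by unfold turn tilt; linarith
    have hupp : turn (depthProfile H) φ < φ + Real.pi := by unfold turn tilt; linarith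
    -- The end point is at angle `turn φ` or opposite to it, so the arc runs forward from `φ` to
    -- `turn φ` or backward from `φ` to `turn φ - π`.
    rcases hu.polarCurve_add_int_mul_pi (turn (depthProfile H) φ) k with h | h
    · rw [h] at harc
      rw [hu.eq_image_uIcc hC harc ⟨by linarith, hupp⟩ (hopp _ hxC), Set.uIcc_of_le hlow.le]
      refine hH.quarterMeasure_image_Icc ν hν fun t ht k => ?_
      rw [← hH.turn_quarter ht, hmono.le_iff_le]
    · have e : -polarCurve (depthProfile H) (turn (depthProfile H) φ)
          = polarCurve (depthProfile H) (turn (depthProfile H) φ - Real.pi) := by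
        rw [neg_eq_iff_eq_neg, ← hu.polarCurve_add_pi, sub_add_cancel]
      rw [h, e] at harc
      rw [hu.eq_image_uIcc hC harc ⟨by linarith, by linarith⟩ (hopp _ hxC),
        Set.uIcc_of_ge (by linarith)]
      refine hH.quarterMeasure_image_Icc ν hν fun t ht k => ?_
      -- Adding `π` moves the orbit by two steps, and `turn` accounts for one of them; monotonicity
      -- of `turn` then compares with `φ` at the step `k + 1`.
      have h1 := hH.turn_quarter ht (k + 1)
      push_cast at h1
      rw [← hmono.le_iff_le (a := φ), h1, sub_le_iff_le_add,
        show arcAngle (t / 3) + k * (Real.pi / 2) + Real.pi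
          = arcAngle (t / 3) + (k + 1 + 1) * (Real.pi / 2) by ring]

end IsDepth
end NormedPlane

open NormedPlane
theorem mainTheorem2 :
    ∃ K : Set Plane,
      IsSymmetricBody K ∧ StrictConvex ℝ K ∧ HasUniqueSupportLines K ∧ HasSmoothBoundary K ∧
      (∃ ρ : ℝ → ℝ, IsCantorBumpRadius ρ ∧
        frontier K = Set.range (fun φ : ℝ => ρ φ • circlePoint φ)) ∧
      (∃ D : Set Plane,
        auerbachSet K = cantorArc ∪ -cantorArc ∪ D ∧
        Disjoint cantorArc (-cantorArc) ∧
        D.Countable ∧ D.Infinite ∧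
        ∀ x ∈ D, ∃ U : Set Plane, IsOpen U ∧ U ∩ auerbachSet K = {x}) ∧
      Measure.hausdorffMeasure 1 (auerbachSet K) = 0 ∧
      ∃ μ : Measure Plane, IsBMeasure K μ := by
  obtain ⟨H, hH⟩ := exists_isDepth
  have hu := hH.isGaugeProfile
  obtain ⟨ν, hprob, hnull, hν⟩ := exists_probabilityMeasure_cantorSet
  refine ⟨polarBody (depthProfile H), hu.isSymmetricBody_polarBody, hu.strictConvex_polarBody,
    hu.hasUniqueSupportLines_polarBody, hu.hasSmoothBoundary_polarBody,
    ⟨_, hH.isCantorBumpRadius, ?_⟩, ⟨_, hH.auerbachSet_eq, disjoint_cantorArc,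
      IsDepth.countable_isolatedPoints H, hH.infinite_isolatedPoints,
      fun x hx => hH.exists_isOpen_inter_auerbachSet hx⟩, hH.hausdorffMeasure_auerbachSet,
    quarterMeasure ν, hH.isBMeasure_quarterMeasure ν hν⟩
  rw [hu.frontier_polarBody]
  exact congrArg Set.range (funext fun s => polarCurve_depthProfile H s)
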